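/- Let $(S,\mathfrak n)$ be a regular local ring and let $I$ be an ideal of $S$ of height $g$ such that the local ring $R=S/I$ is Cohen–Macaulay. Let \[ 0\to G_g\xrightarrow{\ \sigma\ }G_{g-1}\to\cdots\to G_1\to G_0=S\to 0 \] be a minimal free $S$-resolution of $R$, where $G_i=S^{b_i}$, so that the maps are matrices over $S$ with entries in $\mathfrak n$ (for $g=0$, $G_{-1}=0$ and $\sigma=0$). Put $p=b_g$, i.e. $G_g=S^p$, and $\varphi=\sigma^T\otimes R$, a matrix over $R$. A canonical module of $R$ is a finitely generated $R$-module $\omega$ such that, with $k$ the residue field of $R$, $\operatorname{Ext}^i_R(k,\omega)=0$ for $i\ne\dim R$ and $\operatorname{Ext}^i_R(k,\omega)\cong k$ for $i=\dim R$. The Auslander dual $D(\omega)$ formed from a finite free presentation $F_1\xrightarrow{\psi}F_0\to\omega\to0$ is $\operatorname{coker}(\psi^*\colon F_0^*\to F_1^*)$, where ${}^*=\operatorname{Hom}_R(-,R)$. For a matrix $A$, $I_r(A)$ is the ideal generated by its $r\times r$ minors, with $I_0(A)=R$; the unit ideal has height $\infty$. Then $R$ has a canonical module, and every canonical module $\omega_R$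 of $R$ satisfies the following. (1) $\omega_R\cong\operatorname{coker}(\varphi)=\operatorname{coker}(\sigma^T\otimes R)$; in particular, $\operatorname{coker}(\sigma^T\otimes R)$ is a canonical module of $R$. (2) $\varphi$ is the first map of a finite free presentation of $\omega_R$, and the Auslander dual formed from this presentation is $D(\omega_R)\cong\operatorname{coker}(\sigma\otimes R)$. (3) $\omega_R$ is isomorphic to an ideal of $R$ if and only if $\operatorname{ht} I_{p-1}(\varphi)\ge 1$ and $I_p(\varphi)=0$. -/

import Mathlib

open CategoryTheory IsLocalRing

universe u

/-- A Noetherian local ring is Cohen–Macaulay if its depth equals its Krull dimension, that is, if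
the maximal ideal contains a regular sequence of length `dim R` (the length of a regular sequence
in the maximal ideal never exceeds `dim R`). -/
def IsCohenMacaulayLocal (R : Type u) [CommRing R] [IsLocalRing R] : Prop :=
  IsNoetherianRing R ∧ ∃ rs : List R, (∀ r ∈ rs, r ∈ maximalIdeal R) ∧
    RingTheory.Sequence.IsRegular R rs ∧ (rs.length : WithBot ℕ∞) = ringKrullDim R

/-- A canonical module of a local ring `R` with residue field `k`: a finitely generated module `ω`
with `Ext^i_R(k, ω) = 0` for `i ≠ dim R` and `Ext^i_R(k, ω) ≅ k` for `i = dim R`. -/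
structure IsCanonicalModule (R : Type u) [CommRing R] [IsLocalRing R]
    (ω : Type u) [AddCommGroup ω] [Module R ω] : Prop where
  finite : Module.Finite R ω
  ext_eq_zero : ∀ i : ℕ, (i : WithBot ℕ∞) ≠ ringKrullDim R →
    Subsingleton (Abelian.Ext (ModuleCat.of R (ResidueField R)) (ModuleCat.of R ω) i)
  ext_dim : ∀ i : ℕ, (i : WithBot ℕ∞) = ringKrullDim R →
    Nonempty (Abelian.Ext (ModuleCat.of R (ResidueField R)) (ModuleCat.of R ω) i
      ≃ₗ[R] ResidueField R)

/-- A minimal free resolution `0 → G_g → ⋯ → G_1 → G_0 = S → 0` of `S ⧸ I` over a local ring `S`.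
Here `G_i = S ^ (rank i)`, and `d i` is the matrix of the map `G_{i+1} → G_i`. -/
structure MinimalFreeResolution {S : Type u} [CommRing S] [IsLocalRing S] (I : Ideal S)
    (g : ℕ) where
  rank : ℕ → ℕ
  d : ∀ i : ℕ, Matrix (Fin (rank i)) (Fin (rank (i + 1))) S
  augmentation : (Fin (rank 0) → S) →ₗ[S] S ⧸ I
  rank_zero : rank 0 = 1
  rank_eq_zero : ∀ i : ℕ, g < i → rank i = 0
  augmentation_surjective : Function.Surjective augmentation
  exact_zero : Function.Exact (d 0).mulVecLin augmentation
  exact_succ : ∀ i : ℕ, Function.Exact (d (i + 1)).mulVecLin (d i).mulVecLin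
  minimal : ∀ i j k, d i j k ∈ maximalIdeal S

namespace MinimalFreeResolution

variable {S : Type u} [CommRing S] [IsLocalRing S] {I : Ideal S} {g : ℕ}

/-- The rank of `G_{i-1}`, with the convention `G_{-1} = 0`. -/
def prevRank (G : MinimalFreeResolution I g) : ℕ → ℕ
  | 0 => 0
  | i + 1 => G.rank i

/-- The matrix of the map `G_i → G_{i-1}` of the resolution, with the convention `G_{-1} = 0`. -/
def diff (G : MinimalFreeResolution I g) :
    ∀ i : ℕ, Matrix (Fin (G.prevRank i)) (Fin (G.rank i)) S
  | 0 => 0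
  | i + 1 => G.d i

/-- The last map `σ : G_g → G_{g-1}` of the resolution. -/
def lastMap (G : MinimalFreeResolution I g) : Matrix (Fin (G.prevRank g)) (Fin (G.rank g)) S :=
  G.diff g

/-- The matrix `σ ⊗ R` over `R = S ⧸ I`. -/
def lastMapQuot (G : MinimalFreeResolution I g) :
    Matrix (Fin (G.prevRank g)) (Fin (G.rank g)) (S ⧸ I) :=
  G.lastMap.map (Ideal.Quotient.mk I)

/-- The matrix `φ = σᵀ ⊗ R` over `R = S ⧸ I`. -/
def lastMapTransposeQuot (G : MinimalFreeResolution I g) :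
    Matrix (Fin (G.rank g)) (Fin (G.prevRank g)) (S ⧸ I) :=
  G.lastMap.transpose.map (Ideal.Quotient.mk I)

end MinimalFreeResolution

/-- The cokernel of a linear map. -/
abbrev Coker {R M N : Type*} [CommRing R] [AddCommGroup M] [Module R M] [AddCommGroup N]
    [Module R N] (f : M →ₗ[R] N) : Type _ :=
  N ⧸ LinearMap.range f

/-- `F₁ --φ--> F₀ --π--> M → 0` is a finite free presentation of `M`. -/
structure IsFreePresentation {R F₁ F₀ M : Type*} [CommRing R] [AddCommGroup F₁] [Module R F₁]
    [AddCommGroup F₀] [Module R F₀] [AddCommGroup M] [Module R M]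
    (φ : F₁ →ₗ[R] F₀) (π : F₀ →ₗ[R] M) : Prop where
  free₁ : Module.Free R F₁
  finite₁ : Module.Finite R F₁
  free₀ : Module.Free R F₀
  finite₀ : Module.Finite R F₀
  surjective : Function.Surjective π
  exact : Function.Exact φ π

/-- The Auslander dual `D(M) = coker (φ^* : F₀^* → F₁^*)` of a module `M`, formed from a finite
free presentation `F₁ --φ--> F₀ → M → 0`. -/
abbrev AuslanderDual {R F₁ F₀ : Type*} [CommRing R] [AddCommGroup F₁] [Module R F₁]
    [AddCommGroup F₀] [Module R F₀] (φ : F₁ →ₗ[R] F₀) : Type _ :=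
  Coker φ.dualMap

/-- The ideal `I_r(A)` generated by the `r × r` minors of the matrix `A`. -/
def minorsIdeal {R : Type*} [CommRing R] {m n : ℕ} (A : Matrix (Fin m) (Fin n) R) (r : ℕ) :
    Ideal R :=
  Ideal.span {x | ∃ (a : Fin r → Fin m) (b : Fin r → Fin n), x = (A.submatrix a b).det}

/-! Put `R = S/I`, `n = dim S`, `d = dim R`, and let `k` be the residue field. Dualizing the
resolution, whose length is `g`, gives `coker σᵀ ≅ Ext_S^g(R, S)`; since `I` kills this module, it
is also `coker (σᵀ ⊗ R)` (`nonempty_ext_equiv_coker_quot`). As `Ext_S^j(M, S) = 0` for `j < g` and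
finite `R`-modules `M`, and `Ext_S^j(R, S) = 0` for `j > g`, dimension shifting over `R` gives
`Ext_R^i(M, Ext_S^g(R, S)) ≅ Ext_S^{g+i}(M, S)` (`exists_ext_addEquiv`). For `M = k` the right side
is `k` when `g + i = n` and zero otherwise, because the maximal ideal of `S` is generated by a
regular sequence. With `n = g + d` this makes `coker φ` canonical (`isCanonicalModule_coker`).

Uniqueness (`nonempty_linearEquiv`): for canonical modules `ω'` and `ω`, `exists_comp_eq` yields `f
: ω' → ω` that carries a nonzero class of `Extᵈ(k, ω')` to a nonzero class of `Extᵈ(k, ω)`. Both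
modules are simple and the other `Ext` vanish, so `f` is bijective on every `Extⁱ(k, -)`, and
dévissage makes `f` an isomorphism. This gives (1), and (2) is then transposition of matrices.

For (3), a canonical module `W` is faithful and nonzerodivisors of `R` are regular on it. Maximal
minors of `φ` annihilate `coker φ`, so faithfulness forces `I_p(φ) = 0`. The height condition says
that no minimal prime `P` contains all `(p-1)`-minors, that is, `W` is cyclic up to a multiplier
outside `P`. Associated primes of `R` are minimal, so these local generators combine to `s W ⊆ R w₀`
with `s` regular; as `R w₀ ≅ R`, this embeds `W` in `R`. Conversely, an ideal isomorphic to the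
faithful module `W` contains a regular element, which serves as both multiplier and generator. -/

/-! ### `Ext` of modules: functoriality and long exact sequences -/

section ExtToolkit

open Abelian

variable (A : Type u) [CommRing A]

/-- `Ext` groups of modules, with unbundled arguments. -/
abbrev ExtM (M N : Type u) [AddCommGroup M] [Module A M] [AddCommGroup N] [Module A N]
    (i : ℕ) : Type u :=
  Abelian.Ext (ModuleCat.of A M) (ModuleCat.of A N) i

variable {A}
variable {M M' M'' N N' N'' : Type u}
  [AddCommGroup M] [Module A M] [AddCommGroup M'] [Module A M'] [AddCommGroup M''] [Module A M'']
  [AddCommGroup N] [Module A N] [AddCommGroup N'] [Module A N'] [AddCommGroup N''] [Module A N'']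

namespace ExtM

/-- The map on `Ext` induced by a linear map in the first variable. -/
noncomputable def pre (f : M →ₗ[A] M') (N : Type u) [AddCommGroup N] [Module A N] (i : ℕ) :
    ExtM A M' N i →ₗ[A] ExtM A M N i :=
  (Ext.mk₀ (ModuleCat.ofHom f)).precompOfLinear A _ (zero_add i)

/-- The map on `Ext` induced by a linear map in the second variable. -/
noncomputable def post (M : Type u) [AddCommGroup M] [Module A M] (f : N →ₗ[A] N') (i : ℕ) :
    ExtM A M N i →ₗ[A] ExtM A M N' i :=
  (Ext.mk₀ (ModuleCat.ofHom f)).postcompOfLinear A _ (add_zero i)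

lemma pre_apply (f : M →ₗ[A] M') (i : ℕ) (x : ExtM A M' N i) :
    pre f N i x = (Ext.mk₀ (ModuleCat.ofHom f)).comp x (zero_add i) := rfl

lemma post_apply (f : N →ₗ[A] N') (i : ℕ) (x : ExtM A M N i) :
    post M f i x = x.comp (Ext.mk₀ (ModuleCat.ofHom f)) (add_zero i) := rfl

@[simp]
lemma pre_id (i : ℕ) (x : ExtM A M N i) : pre LinearMap.id N i x = x := by
  rw [pre_apply, ModuleCat.ofHom_id]
  exact Ext.mk₀_id_comp x

@[simp]
lemma post_id (i : ℕ) (x : ExtM A M N i) : post M LinearMap.id i x = x := by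
  rw [post_apply, ModuleCat.ofHom_id]
  exact Ext.comp_mk₀_id x

lemma pre_comp (f : M →ₗ[A] M') (g : M' →ₗ[A] M'') (i : ℕ) (x : ExtM A M'' N i) :
    pre (g ∘ₗ f) N i x = pre f N i (pre g N i x) := by
  simp only [pre_apply, ModuleCat.ofHom_comp, Ext.mk₀_comp_mk₀_assoc]

lemma post_comp (f : N →ₗ[A] N') (g : N' →ₗ[A] N'') (i : ℕ) (x : ExtM A M N i) :
    post M (g ∘ₗ f) i x = post M g i (post M f i x) := by
  simp only [post_apply, ModuleCat.ofHom_comp, Ext.comp_assoc_of_third_deg_zero, Ext.mk₀_comp_mk₀]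

lemma pre_post (f : M →ₗ[A] M') (g : N →ₗ[A] N') (i : ℕ) (x : ExtM A M' N i) :
    pre f N' i (post M' g i x) = post M g i (pre f N i x) := by
  simp only [post_apply, pre_apply, Ext.comp_assoc_of_third_deg_zero]

lemma pre_zero (i : ℕ) (x : ExtM A M' N i) : pre (0 : M →ₗ[A] M') N i x = 0 := by
  rw [pre_apply]
  have : ModuleCat.ofHom (0 : M →ₗ[A] M') = 0 := rfl
  rw [this, Ext.mk₀_zero, Ext.zero_comp]

lemma pre_add (f g : M →ₗ[A] M') (i : ℕ) (x : ExtM A M' N i) :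
    pre (f + g) N i x = pre f N i x + pre g N i x := by
  simp only [pre_apply]
  rw [show ModuleCat.ofHom (f + g) = ModuleCat.ofHom f + ModuleCat.ofHom g from rfl,
    Ext.mk₀_add, Ext.add_comp]

lemma pre_smul (r : A) (f : M →ₗ[A] M') (i : ℕ) (x : ExtM A M' N i) :
    pre (r • f) N i x = r • pre f N i x := by
  simp only [pre_apply]
  rw [show ModuleCat.ofHom (r • f) = r • ModuleCat.ofHom f from rfl, Ext.mk₀_smul, Ext.smul_comp]

lemma post_smul (r : A) (f : N →ₗ[A] N') (i : ℕ) (x : ExtM A M N i) :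
    post M (r • f) i x = r • post M f i x := by
  simp only [post_apply]
  rw [show ModuleCat.ofHom (r • f) = r • ModuleCat.ofHom f from rfl, Ext.mk₀_smul, Ext.comp_smul]

lemma post_add (f g : N →ₗ[A] N') (i : ℕ) (x : ExtM A M N i) :
    post M (f + g) i x = post M f i x + post M g i x := by
  simp only [post_apply]
  rw [show ModuleCat.ofHom (f + g) = ModuleCat.ofHom f + ModuleCat.ofHom g from rfl,
    Ext.mk₀_add, Ext.comp_add]

/-- `pre` as an additive map in the linear map. -/
noncomputable def preHom (i : ℕ) (x : ExtM A M' N i) : (M →ₗ[A] M') →ₗ[A] ExtM A M N i where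
  toFun f := pre f N i x
  map_add' f g := pre_add f g i x
  map_smul' r f := pre_smul r f i x

/-- `post` as an additive map in the linear map. -/
noncomputable def postHom (i : ℕ) (x : ExtM A M N i) : (N →ₗ[A] N') →ₗ[A] ExtM A M N' i where
  toFun f := post M f i x
  map_add' f g := post_add f g i x
  map_smul' r f := post_smul r f i x

lemma pre_sum {ι : Type*} (s : Finset ι) (f : ι → M →ₗ[A] M') (i : ℕ) (x : ExtM A M' N i) :
    pre (∑ j ∈ s, f j) N i x = ∑ j ∈ s, pre (f j) N i x :=
  map_sum (preHom i x) f s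

lemma post_sum {ι : Type*} (s : Finset ι) (f : ι → N →ₗ[A] N') (i : ℕ) (x : ExtM A M N i) :
    post M (∑ j ∈ s, f j) i x = ∑ j ∈ s, post M (f j) i x :=
  map_sum (postHom i x) f s

/-- Isomorphic modules have isomorphic `Ext` in the first variable. -/
noncomputable def congrLeft (e : M ≃ₗ[A] M') (N : Type u) [AddCommGroup N] [Module A N] (i : ℕ) :
    ExtM A M N i ≃ₗ[A] ExtM A M' N i :=
  LinearEquiv.ofLinearMap (pre e.symm.toLinearMap N i) (pre e.toLinearMap N i)
    (by ext x; simp [← pre_comp]) (by ext x; simp [← pre_comp])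

lemma smul_eq_zero_of_annihilator_left {r : A} (hr : ∀ m : M, r • m = 0) (i : ℕ)
    (x : ExtM A M N i) : r • x = 0 := by
  have h : r • (LinearMap.id : M →ₗ[A] M) = 0 := by ext m; simpa using hr m
  rw [← pre_id i x, ← pre_smul, h, pre_zero]

lemma smul_eq_zero_of_annihilator_right {r : A} (hr : ∀ m : N, r • m = 0) (i : ℕ)
    (x : ExtM A M N i) : r • x = 0 := by
  have h : r • (LinearMap.id : N →ₗ[A] N) = 0 := by ext m; simpa using hr m
  rw [← post_id i x, ← post_smul, h]
  exact map_zero (postHom i x)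

/-- `Ext⁰` is `Hom`. -/
noncomputable def zeroEquiv : ExtM A M N 0 ≃ₗ[A] (M →ₗ[A] N) :=
  Ext.linearEquiv₀.trans ModuleCat.homLinearEquiv

lemma zeroEquiv_symm_apply (f : M →ₗ[A] N) :
    zeroEquiv.symm f = Ext.mk₀ (ModuleCat.ofHom f) := rfl

lemma pre_zeroEquiv_symm (f : M →ₗ[A] M') (g : M' →ₗ[A] N) :
    pre f N 0 (zeroEquiv.symm g) = zeroEquiv.symm (g ∘ₗ f) := by
  simp only [pre_apply, zeroEquiv_symm_apply, Ext.mk₀_comp_mk₀, ModuleCat.ofHom_comp]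

lemma post_zeroEquiv_symm (f : N →ₗ[A] N') (g : M →ₗ[A] N) :
    post M f 0 (zeroEquiv.symm g) = zeroEquiv.symm (f ∘ₗ g) := by
  simp only [post_apply, zeroEquiv_symm_apply, Ext.mk₀_comp_mk₀, ModuleCat.ofHom_comp]

lemma zeroEquiv_pre (f : M →ₗ[A] M') (x : ExtM A M' N 0) :
    zeroEquiv (pre f N 0 x) = zeroEquiv x ∘ₗ f := by
  obtain ⟨g, rfl⟩ := zeroEquiv.symm.surjective x
  rw [pre_zeroEquiv_symm, LinearEquiv.apply_symm_apply, LinearEquiv.apply_symm_apply]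

lemma zeroEquiv_post (f : N →ₗ[A] N') (x : ExtM A M N 0) :
    zeroEquiv (post M f 0 x) = f ∘ₗ zeroEquiv x := by
  obtain ⟨g, rfl⟩ := zeroEquiv.symm.surjective x
  rw [post_zeroEquiv_symm, LinearEquiv.apply_symm_apply, LinearEquiv.apply_symm_apply]

lemma subsingleton_of_subsingleton_left [Subsingleton M] (i : ℕ) :
    Subsingleton (ExtM A M N i) := by
  refine subsingleton_of_forall_eq 0 fun x ↦ ?_
  rw [← one_smul A x]
  exact smul_eq_zero_of_annihilator_left (fun m ↦ Subsingleton.elim _ _) i x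

lemma subsingleton_of_projective [Module.Projective A M] (i : ℕ) :
    Subsingleton (ExtM A M N (i + 1)) := by
  have : Projective (ModuleCat.of A M) :=
    (IsProjective.iff_projective (R := A) M).mp inferInstance
  exact Ext.subsingleton_of_projective _ _ i

/-- `Ext` of a finite power of a module in the first variable vanishes if that of the module
does. -/
lemma subsingleton_pi_left {n : ℕ} {i : ℕ} (h : Subsingleton (ExtM A M N i)) :
    Subsingleton (ExtM A (Fin n → M) N i) := by
  refine subsingleton_of_forall_eq 0 fun x ↦ ?_
  have hid : (LinearMap.id : (Fin n → M) →ₗ[A] (Fin n → M)) =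
      ∑ j, LinearMap.single A (fun _ ↦ M) j ∘ₗ LinearMap.proj j :=
    by ext; simp [Pi.single_apply, Finset.sum_apply]
  rw [← pre_id i x, hid, pre_sum]
  refine Finset.sum_eq_zero fun j _ ↦ ?_
  rw [pre_comp, Subsingleton.elim (pre (LinearMap.single A (fun _ ↦ M) j) N i x) 0, map_zero]

/-- `Ext` of a finite power of a module in the second variable vanishes if that of the module
does. -/
lemma subsingleton_pi_right {n : ℕ} {i : ℕ} (h : Subsingleton (ExtM A M N i)) :
    Subsingleton (ExtM A M (Fin n → N) i) := by
  refine subsingleton_of_forall_eq 0 fun x ↦ ?_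
  have hid : (LinearMap.id : (Fin n → N) →ₗ[A] (Fin n → N)) =
      ∑ j, LinearMap.single A (fun _ ↦ N) j ∘ₗ LinearMap.proj j :=
    by ext; simp [Pi.single_apply, Finset.sum_apply]
  rw [← post_id i x, hid, post_sum]
  refine Finset.sum_eq_zero fun j _ ↦ ?_
  rw [post_comp, Subsingleton.elim (post M (LinearMap.proj j : (Fin n → N) →ₗ[A] N) i x) 0,
    map_zero]

end ExtM

/-- `0 → M → M' → M'' → 0` is a short exact sequence. -/
structure IsShortExact (f : M →ₗ[A] M') (g : M' →ₗ[A] M'') : Prop where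
  injective : Function.Injective f
  surjective : Function.Surjective g
  exact : Function.Exact f g

namespace IsShortExact

variable {f : M →ₗ[A] M'} {g : M' →ₗ[A] M''}

lemma shortExact (h : IsShortExact f g) :
    (ModuleCat.shortComplexOfCompEqZero f g h.exact.linearMap_comp_eq_zero).ShortExact where
  exact := ModuleCat.shortComplex_exact _ h.exact
  mono_f := (ModuleCat.mono_iff_injective _).mpr h.injective
  epi_g := (ModuleCat.epi_iff_surjective _).mpr h.surjective

/-- The class of a short exact sequence in `Ext¹`. -/
noncomputable def cls (h : IsShortExact f g) : ExtM A M'' M 1 := h.shortExact.extClass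

/-- The contravariant connecting map. -/
noncomputable def preδ (h : IsShortExact f g) (N : Type u) [AddCommGroup N] [Module A N] (i : ℕ) :
    ExtM A M N i →ₗ[A] ExtM A M'' N (i + 1) :=
  h.cls.precompOfLinear A _ (add_comm 1 i)

/-- The covariant connecting map. -/
noncomputable def postδ (h : IsShortExact f g) (N : Type u) [AddCommGroup N] [Module A N] (i : ℕ) :
    ExtM A N M'' i →ₗ[A] ExtM A N M (i + 1) :=
  h.cls.postcompOfLinear A _ rfl

lemma preδ_apply (h : IsShortExact f g) (i : ℕ) (x : ExtM A M N i) :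
    h.preδ N i x = Ext.comp h.cls x (add_comm 1 i) := rfl

lemma postδ_apply (h : IsShortExact f g) (i : ℕ) (x : ExtM A N M'' i) :
    h.postδ N i x = Ext.comp x h.cls rfl := rfl

open ExtM

lemma pre_exact₂ (h : IsShortExact f g) (i : ℕ) :
    Function.Exact (pre g N i) (pre f N i) :=
  (ShortComplex.ab_exact_iff_function_exact _).mp
    (Ext.contravariant_sequence_exact₂' h.shortExact (ModuleCat.of A N) i)

lemma pre_exact₁ (h : IsShortExact f g) (i : ℕ) :
    Function.Exact (pre f N i) (h.preδ N i) :=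
  (ShortComplex.ab_exact_iff_function_exact _).mp
    (Ext.contravariant_sequence_exact₁' h.shortExact (ModuleCat.of A N) i (i + 1) (add_comm 1 i))

lemma pre_exact₃ (h : IsShortExact f g) (i : ℕ) :
    Function.Exact (h.preδ N i) (pre g N (i + 1)) :=
  (ShortComplex.ab_exact_iff_function_exact _).mp
    (Ext.contravariant_sequence_exact₃' h.shortExact (ModuleCat.of A N) i (i + 1) (add_comm 1 i))

lemma post_exact₃ (h : IsShortExact f g) (i : ℕ) :
    Function.Exact (post N g i) (h.postδ N i) :=
  (ShortComplex.ab_exact_iff_function_exact _).mp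
    (Ext.covariant_sequence_exact₃' (ModuleCat.of A N) h.shortExact i (i + 1) rfl)

lemma post_exact₁ (h : IsShortExact f g) (i : ℕ) :
    Function.Exact (h.postδ N i) (post N f (i + 1)) :=
  (ShortComplex.ab_exact_iff_function_exact _).mp
    (Ext.covariant_sequence_exact₁' (ModuleCat.of A N) h.shortExact i (i + 1) rfl)

lemma pre_injective_zero (h : IsShortExact f g) : Function.Injective (pre g N 0) := by
  have := h.shortExact.epi_g
  exact Ext.precomp_mk₀_injective_of_epi _ (ModuleCat.ofHom g)

lemma post_preδ (h : IsShortExact f g) (φ : N →ₗ[A] N') (i : ℕ) (x : ExtM A M N i) :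
    post M'' φ (i + 1) (h.preδ N i x) = h.preδ N' i (post M φ i x) := by
  simp only [post_apply, preδ_apply, Ext.comp_assoc_of_third_deg_zero]

end IsShortExact

/-- The short exact sequence `0 → ker g → M → M'' → 0`. -/
lemma isShortExact_ker {g : M →ₗ[A] M''} (hg : Function.Surjective g) :
    IsShortExact (LinearMap.ker g).subtype g :=
  ⟨Subtype.val_injective, hg, fun x ↦ by simp⟩

/-- The short exact sequence `0 → P → M → M / P → 0`. -/
lemma isShortExact_mkQ (P : Submodule A M) : IsShortExact P.subtype P.mkQ :=
  ⟨Subtype.val_injective, P.mkQ_surjective, fun x ↦ by simp⟩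

open Pointwise in
/-- The short exact sequence `0 → M → M → M / rM → 0` given by a regular element. -/
lemma IsSMulRegular.isShortExact {r : A} (h : IsSMulRegular M r) :
    IsShortExact (r • LinearMap.id : M →ₗ[A] M) (r • (⊤ : Submodule A M)).mkQ :=
  ⟨h, Submodule.mkQ_surjective _, LinearMap.exact_lsmul_mkQ_smul_top M r⟩

end ExtToolkit

/-! ### Vanishing of `Ext` and dévissage to the residue field -/

section LocalRing

open ExtM Pointwise

variable {A : Type u} [CommRing A]

/-- Nakayama's lemma, in the form used below for `Ext` modules and for kernels and cokernels of maps
between them. -/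
lemma subsingleton_of_smul_surjective [IsLocalRing A] {E : Type*} [AddCommGroup E] [Module A E]
    [Module.Finite A E] {x : A} (hx : x ∈ maximalIdeal A) (h : ∀ e : E, ∃ e' : E, x • e' = e) :
    Subsingleton E := by
  by_contra! hE
  refine Submodule.top_ne_pointwise_smul_of_mem_jacobson_annihilator (M := E)
    (maximalIdeal_le_jacobson _ hx) ?_
  rw [eq_comm, eq_top_iff]
  intro e _
  obtain ⟨e', rfl⟩ := h e
  exact Submodule.smul_mem_pointwise_smul _ _ ⊤ trivial

variable {M N N' : Type u} [AddCommGroup M] [Module A M] [AddCommGroup N] [Module A N]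
  [AddCommGroup N'] [Module A N']

/-- `Extⁱ(M, N)` vanishes below the length of an `N`-regular sequence annihilating `M`. -/
lemma ext_subsingleton_of_isWeaklyRegular {rs : List A}
    (reg : RingTheory.Sequence.IsWeaklyRegular N rs) (hrs : ∀ r ∈ rs, ∀ m : M, r • m = 0)
    {i : ℕ} (hi : i < rs.length) : Subsingleton (ExtM A M N i) := by
  induction rs generalizing N i with
  | nil => simp at hi
  | cons r rs ih =>
    rw [RingTheory.Sequence.isWeaklyRegular_cons_iff] at reg
    have hr : ∀ m : M, r • m = 0 := hrs r (by simp)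
    refine subsingleton_of_forall_eq 0 fun x ↦ ?_
    match i with
    | 0 =>
      apply zeroEquiv.injective
      ext m
      refine reg.1 ?_
      simp only [map_zero, LinearMap.zero_apply, smul_zero, ← map_smul, hr]
    | i + 1 =>
      have h := reg.1.isShortExact
      have hx : post M (r • LinearMap.id : N →ₗ[A] N) (i + 1) x = 0 := by
        rw [post_smul, post_id, smul_eq_zero_of_annihilator_left hr]
      obtain ⟨y, rfl⟩ := (h.post_exact₁ i x).mp hx
      have := ih reg.2 (fun r hr ↦ hrs r (by simp [hr])) (i := i) (by simpa using hi)
      rw [Subsingleton.elim y 0, map_zero]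

lemma exists_mem_maximalIdeal_notMem [IsLocalRing A] {p : Ideal A} (hp : p ≠ ⊤)
    (hpm : p ≠ maximalIdeal A) :
    ∃ x ∈ maximalIdeal A, x ∉ p := by
  by_contra! h
  exact hpm (le_antisymm (le_maximalIdeal hp) h)

lemma isSMulRegular_of_equiv_quotient_prime {p : Ideal A} [p.IsPrime] (e : M ≃ₗ[A] A ⧸ p) {x : A}
    (hx : x ∉ p) : IsSMulRegular M x := by
  rw [LinearEquiv.isSMulRegular_congr e]
  intro a b hab
  obtain ⟨a, rfl⟩ := Ideal.Quotient.mk_surjective a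
  obtain ⟨b, rfl⟩ := Ideal.Quotient.mk_surjective b
  simp only [Algebra.smul_def, Ideal.Quotient.algebraMap_eq] at hab
  exact mul_left_cancel₀ (fun h ↦ hx (Ideal.Quotient.eq_zero_iff_mem.mp h)) hab

lemma annihilator_eq_of_equiv_quotient {p : Ideal A} (e : M ≃ₗ[A] A ⧸ p) :
    Module.annihilator A M = p := by
  rw [e.annihilator_eq, Ideal.annihilator_quotient]

variable [IsLocalRing A] [IsNoetherianRing A]

instance : Module.Finite A (ResidueField A) :=
  Module.Finite.of_surjective (Algebra.linearMap A (ResidueField A)) residue_surjective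

/-- `Extⁱ(M, N)` vanishes for `i + dim M < t` if `Extⁱ(k, N)` vanishes for `i < t`. -/
lemma ext_subsingleton_of_supportDim_le [Module.Finite A N] {t : ℕ}
    (hN : ∀ i < t, Subsingleton (ExtM A (ResidueField A) N i)) (e : ℕ)
    (M : Type u) [AddCommGroup M] [Module A M] [hM : Module.Finite A M]
    (he : Module.supportDim A M ≤ e) {i : ℕ} (hi : i + e < t) : Subsingleton (ExtM A M N i) := by
  induction e using Nat.strong_induction_on generalizing M i with
  | _ e ihe =>
  revert i
  induction hM using IsNoetherianRing.induction_on_isQuotientEquivQuotientPrime A with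
  | subsingleton M => exact fun _ ↦ subsingleton_of_subsingleton_left _
  | quotient M p f =>
    intro i hi
    have := p.2
    by_cases hp : p.1 = maximalIdeal A
    · have := hN i (by omega)
      let f' : M ≃ₗ[A] ResidueField A := f.trans (Submodule.quotEquivOfEq _ _ hp)
      exact (congrLeft f' N i).toEquiv.subsingleton
    · obtain ⟨x, hxm, hxp⟩ := exists_mem_maximalIdeal_notMem p.2.ne_top hp
      have reg : IsSMulRegular M x := isSMulRegular_of_equiv_quotient_prime f hxp
      have hdim := Module.supportDim_quotSMulTop_succ_eq_supportDim reg hxm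
      -- `dim M / xM < dim M`, so the outer induction kills `Extⁱ⁺¹(M / xM, N)`; hence `x` acts
      -- surjectively on `Extⁱ(M, N)` and Nakayama applies.
      have key : Subsingleton (ExtM A (QuotSMulTop x M) N (i + 1)) := by
        by_cases hs : Subsingleton (QuotSMulTop x M)
        · exact subsingleton_of_subsingleton_left _
        · rw [← Module.supportDim_eq_bot_iff_subsingleton A] at hs
          obtain ⟨c, hc⟩ := WithBot.ne_bot_iff_exists.mp hs
          rw [← hdim, ← hc] at he
          have he' : c + 1 ≤ (e : ℕ∞) := by exact_mod_cast he
          obtain ⟨c, rfl⟩ : ∃ n : ℕ, c = n := by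
            refine ENat.ne_top_iff_exists.mp (fun h ↦ ?_) |>.imp fun _ h ↦ h.symm
            simp [h] at he'
          have he'' : c + 1 ≤ e := by exact_mod_cast he'
          exact ihe c (by omega) (QuotSMulTop x M) (by rw [← hc]; rfl) (by omega)
      refine subsingleton_of_smul_surjective hxm fun y ↦ ?_
      obtain ⟨z, hz⟩ := (reg.isShortExact.pre_exact₁ i y).mp (key.elim _ _)
      exact ⟨z, by rw [← hz, pre_smul, pre_id]⟩
  | exact M₁ M₂ M₃ f g hf hg hfg h₁ h₃ =>
    intro i hi
    have h : IsShortExact f g := ⟨hf, hg, hfg⟩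
    have s₁ := h₁ ((Module.supportDim_le_of_injective f hf).trans he) hi
    have s₃ := h₃ ((Module.supportDim_le_of_surjective g hg).trans he) hi
    refine subsingleton_of_forall_eq 0 fun x ↦ ?_
    obtain ⟨y, rfl⟩ := (h.pre_exact₂ i x).mp (s₁.elim _ _)
    rw [s₃.elim y 0, map_zero]

/-- Induction principle: a property of finitely generated modules over a Noetherian local ring
that holds for the residue field, is stable under extensions, and passes from `M / xM` to `M` for
`M`-regular `x` in the maximal ideal holds for all modules. -/
theorem finite_module_induction
    {motive : (M : Type u) → [AddCommGroup M] → [Module A M] → [Module.Finite A M] → Prop}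
    (subsingleton : ∀ (M : Type u) [AddCommGroup M] [Module A M] [Module.Finite A M]
      [Subsingleton M], motive M)
    (residue : ∀ (M : Type u) [AddCommGroup M] [Module A M] [Module.Finite A M],
      (M ≃ₗ[A] ResidueField A) → motive M)
    (exact : ∀ (M₁ M₂ M₃ : Type u) [AddCommGroup M₁] [Module A M₁] [Module.Finite A M₁]
      [AddCommGroup M₂] [Module A M₂] [Module.Finite A M₂]
      [AddCommGroup M₃] [Module A M₃] [Module.Finite A M₃] (f : M₁ →ₗ[A] M₂) (g : M₂ →ₗ[A] M₃),
      IsShortExact f g → motive M₁ → motive M₃ → motive M₂)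
    (regular : ∀ (M : Type u) [AddCommGroup M] [Module A M] [Module.Finite A M] (x : A),
      x ∈ maximalIdeal A → IsSMulRegular M x → motive (QuotSMulTop x M) → motive M)
    ⦃M : Type u⦄ [AddCommGroup M] [Module A M] (_ : Module.Finite A M) : motive M := by
  -- Noetherian induction on an ideal `a` killing `M`, a bound inherited by submodules and
  -- quotients. Since `M / xM` is also killed by `x ∉ a`, the bound grows strictly there.
  suffices H : ∀ (a : Ideal A) (M : Type u) [AddCommGroup M] [Module A M] [Module.Finite A M],
      a ≤ Module.annihilator A M → motive M from H ⊥ M bot_le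
  intro a
  induction a using WellFoundedGT.induction with
  | _ a iha =>
  intro M _ _ hM ha
  induction hM using IsNoetherianRing.induction_on_isQuotientEquivQuotientPrime A with
  | subsingleton M => exact subsingleton M
  | quotient M p f =>
    have := p.2
    by_cases hp : p.1 = maximalIdeal A
    · exact residue M (f.trans (Submodule.quotEquivOfEq _ _ hp))
    · obtain ⟨x, hxm, hxp⟩ := exists_mem_maximalIdeal_notMem p.2.ne_top hp
      refine regular M x hxm (isSMulRegular_of_equiv_quotient_prime f hxp) ?_
      have hap : a ≤ p.1 := ha.trans (annihilator_eq_of_equiv_quotient f).le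
      refine iha (a ⊔ Ideal.span {x}) ?_ _ (sup_le ?_ ?_)
      · refine lt_of_le_of_ne le_sup_left fun h ↦ hxp (hap ?_)
        rw [h]
        exact Ideal.mem_sup_right (Ideal.mem_span_singleton_self x)
      · exact ha.trans (LinearMap.annihilator_le_of_surjective _ (Submodule.mkQ_surjective _))
      · rw [Ideal.span_singleton_le_iff_mem]
        exact QuotSMulTop.mem_annihilator M x
  | exact M₁ M₂ M₃ f g hf hg hfg h₁ h₃ =>
    exact exact M₁ M₂ M₃ f g ⟨hf, hg, hfg⟩
      (h₁ (ha.trans (LinearMap.annihilator_le_of_injective f hf)))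
      (h₃ (ha.trans (LinearMap.annihilator_le_of_surjective g hg)))

/-- `Extⁱ(M, N)` vanishes for `i > t` if `Extⁱ(k, N)` does. -/
lemma ext_subsingleton_of_lt [Module.Finite A N] {t : ℕ}
    (hN : ∀ i, t < i → Subsingleton (ExtM A (ResidueField A) N i))
    (M : Type u) [AddCommGroup M] [Module A M] [hM : Module.Finite A M] :
    ∀ i, t < i → Subsingleton (ExtM A M N i) := by
  induction hM using finite_module_induction with
  | subsingleton M => exact fun i _ ↦ subsingleton_of_subsingleton_left i
  | residue M e => exact fun i hi ↦ have := hN i hi; (congrLeft e N i).toEquiv.subsingleton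
  | exact M₁ M₂ M₃ f g h h₁ h₃ =>
    refine fun i hi ↦ subsingleton_of_forall_eq 0 fun x ↦ ?_
    obtain ⟨y, rfl⟩ := (h.pre_exact₂ i x).mp ((h₁ i hi).elim _ _)
    rw [(h₃ i hi).elim y 0, map_zero]
  | regular M x hx reg ih =>
    refine fun i hi ↦ subsingleton_of_smul_surjective hx fun y ↦ ?_
    obtain ⟨z, hz⟩ := (reg.isShortExact.pre_exact₁ i y).mp ((ih (i + 1) (by omega)).elim _ _)
    exact ⟨z, by rw [← hz, pre_smul, pre_id]⟩

/-- A map inducing isomorphisms on all `Extⁱ(k, -)` induces isomorphisms on all `Extⁱ(M, -)`. -/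
lemma post_bijective_of_residueField [Module.Finite A N] [Module.Finite A N'] (φ : N →ₗ[A] N')
    (hφ : ∀ i, Function.Bijective (post (ResidueField A) φ i))
    (M : Type u) [AddCommGroup M] [Module A M] [hM : Module.Finite A M] :
    ∀ i, Function.Bijective (post M φ i) := by
  induction hM using finite_module_induction with
  | subsingleton M =>
    intro i
    have := subsingleton_of_subsingleton_left (A := A) (M := M) (N := N) i
    have := subsingleton_of_subsingleton_left (A := A) (M := M) (N := N') i
    exact ⟨Function.injective_of_subsingleton _, fun y ↦ ⟨0, Subsingleton.elim _ _⟩⟩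
  | residue M e =>
    intro i
    have h : post M φ i = (congrLeft e.symm N' i).toLinearMap ∘ₗ post (ResidueField A) φ i ∘ₗ
        (congrLeft e N i).toLinearMap := by
      ext x
      simp only [LinearMap.comp_apply, LinearEquiv.coe_coe]
      change _ = pre e.toLinearMap N' i (post _ φ i (pre e.symm.toLinearMap N i x))
      rw [pre_post, ← pre_comp]
      simp
    rw [h]
    simpa using hφ i
  | exact M₁ M₂ M₃ f g h h₁ h₃ =>
    intro i
    refine ⟨(injective_iff_map_eq_zero _).mpr fun x hx ↦ ?_, fun x ↦ ?_⟩
    · have h0 : pre f N i x = 0 := by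
        apply (h₁ i).1
        rw [← pre_post, hx, map_zero, map_zero]
      obtain ⟨y, rfl⟩ := (h.pre_exact₂ i x).mp h0
      rw [← pre_post] at hx
      match i with
      | 0 =>
        have := h.pre_injective_zero (hx.trans (map_zero _).symm)
        rw [(h₃ 0).1 (this.trans (map_zero _).symm), map_zero]
      | i + 1 =>
        obtain ⟨z, hz⟩ := (h.pre_exact₃ i _).mp hx
        obtain ⟨z, rfl⟩ := (h₁ i).2 z
        rw [← h.post_preδ] at hz
        rw [← (h₃ (i + 1)).1 hz]
        exact (h.pre_exact₃ i).apply_apply_eq_zero z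
    · obtain ⟨y, hy⟩ := (h₁ i).2 (pre f N' i x)
      have hy0 : h.preδ N i y = 0 := by
        apply (h₃ (i + 1)).1
        rw [h.post_preδ, hy, map_zero]
        exact (h.pre_exact₁ i).apply_apply_eq_zero x
      obtain ⟨z, rfl⟩ := (h.pre_exact₁ i y).mp hy0
      have : pre f N' i (x - post M₂ φ i z) = 0 := by rw [map_sub, pre_post, hy, sub_self]
      obtain ⟨w, hw⟩ := (h.pre_exact₂ i _).mp this
      obtain ⟨w, rfl⟩ := (h₃ i).2 w
      refine ⟨z + pre g N i w, ?_⟩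
      rw [map_add, ← pre_post, hw, add_sub_cancel]
  | regular M x hx reg ih =>
    have h := reg.isShortExact
    have hpre (N : Type u) [AddCommGroup N] [Module A N] (i : ℕ) (y : ExtM A M N i) :
        pre (x • LinearMap.id : M →ₗ[A] M) N i y = x • y := by rw [pre_smul, pre_id]
    -- The kernel equals `x` times itself: if `a = x a'`, then `a'` is corrected into the kernel by
    -- a class pulled back from `Extⁱ(M / xM, N)`, which `x` kills.
    have inj (i : ℕ) : Function.Injective (post M φ i) := by
      rw [← LinearMap.ker_eq_bot, ← Submodule.subsingleton_iff_eq_bot]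
      refine subsingleton_of_smul_surjective hx fun ⟨a, ha⟩ ↦ ?_
      rw [LinearMap.mem_ker] at ha
      have hδ : h.preδ N i a = 0 := by
        apply (ih (i + 1)).1
        rw [h.post_preδ, ha, map_zero, map_zero]
      obtain ⟨a', rfl⟩ := (h.pre_exact₁ i a).mp hδ
      rw [← pre_post] at ha
      obtain ⟨b, hb⟩ := (h.pre_exact₂ i _).mp ha
      obtain ⟨b', rfl⟩ := (ih i).2 b
      refine ⟨⟨a' - pre (x • (⊤ : Submodule A M)).mkQ N i b', ?_⟩, ?_⟩
      · rw [LinearMap.mem_ker, map_sub, ← pre_post, hb, sub_self]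
      · ext
        simp only [Submodule.coe_smul]
        rw [← hpre, map_sub, (h.pre_exact₂ i).apply_apply_eq_zero, sub_zero]
    refine fun i ↦ ⟨inj i, ?_⟩
    -- Nakayama for the cokernel: modulo the range, every class is `x` times another one. This uses
    -- injectivity one degree higher.
    rw [← LinearMap.range_eq_top, ← Submodule.Quotient.subsingleton_iff]
    refine subsingleton_of_smul_surjective hx fun c ↦ ?_
    obtain ⟨c, rfl⟩ := Submodule.mkQ_surjective _ c
    obtain ⟨e, he⟩ := (ih (i + 1)).2 (h.preδ N' i c)
    have he0 : pre (x • (⊤ : Submodule A M)).mkQ N (i + 1) e = 0 := by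
      apply inj (i + 1)
      rw [← pre_post, he, map_zero]
      exact (h.pre_exact₃ i).apply_apply_eq_zero c
    obtain ⟨c', rfl⟩ := (h.pre_exact₃ i e).mp he0
    have : h.preδ N' i (c - post M φ i c') = 0 := by rw [map_sub, ← h.post_preδ, he, sub_self]
    obtain ⟨c'', hc''⟩ := (h.pre_exact₁ i _).mp this
    refine ⟨(LinearMap.range (post M φ i)).mkQ c'', ?_⟩
    rw [← map_smul, ← hpre, hc'', map_sub, sub_eq_self]
    simp

/-- A map inducing isomorphisms on all `Extⁱ(k, -)` is an isomorphism. -/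
lemma bijective_of_residueField [Module.Finite A N] [Module.Finite A N'] (φ : N →ₗ[A] N')
    (hφ : ∀ i, Function.Bijective (post (ResidueField A) φ i)) : Function.Bijective φ := by
  -- Take `M = A`, where `Ext⁰(A, N)` is `N` itself.
  have h := post_bijective_of_residueField φ hφ A 0
  have key (x : N) : zeroEquiv (post A φ 0 (zeroEquiv.symm (LinearMap.toSpanSingleton A N x))) =
      LinearMap.toSpanSingleton A N' (φ x) := by
    rw [zeroEquiv_post, LinearEquiv.apply_symm_apply]
    ext
    simp
  constructor
  · intro x y hxy
    have := key x
    rw [hxy, ← key y] at this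
    have := zeroEquiv.symm.injective (h.1 (zeroEquiv.injective this))
    simpa using LinearMap.congr_fun this 1
  · intro y
    obtain ⟨x, hx⟩ := h.2 (zeroEquiv.symm (LinearMap.toSpanSingleton A N' y))
    refine ⟨zeroEquiv x 1, ?_⟩
    have := zeroEquiv_post φ x
    rw [hx, LinearEquiv.apply_symm_apply] at this
    simpa using (LinearMap.congr_fun this 1).symm

end LocalRing

/-! ### Canonical modules: regular sequences, uniqueness, faithfulness -/

section CanonicalModule

open ExtM Pointwise RingTheory.Sequence

variable {A : Type u} [CommRing A] [IsLocalRing A]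

instance : IsSimpleModule A (ResidueField A) :=
  isSimpleModule_iff_quot_maximal.mpr
    ⟨maximalIdeal A, inferInstance, ⟨LinearEquiv.refl A (A ⧸ maximalIdeal A)⟩⟩

lemma exists_eq_add_one_of_add_one_le {x : WithBot ℕ∞} (hx : x ≠ ⊥) {t : ℕ} (h : x + 1 ≤ t) :
    ∃ c : ℕ, t = c + 1 ∧ x ≤ c := by
  obtain ⟨c, rfl⟩ := WithBot.ne_bot_iff_exists.mp hx
  have h' : c + 1 ≤ (t : ℕ∞) := by exact_mod_cast h
  obtain ⟨c, rfl⟩ : ∃ n : ℕ, c = n := by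
    refine ENat.ne_top_iff_exists.mp (fun h ↦ ?_) |>.imp fun _ h ↦ h.symm
    simp [h] at h'
  have h'' : c + 1 ≤ t := by exact_mod_cast h'
  refine ⟨t - 1, by omega, ?_⟩
  have : (c : ℕ∞) ≤ ((t - 1 : ℕ) : ℕ∞) := by exact_mod_cast (by omega : c ≤ t - 1)
  exact WithBot.coe_le_coe.mpr this

lemma supportDim_nonpos_of_maximalIdeal_pow_le {M : Type u} [AddCommGroup M] [Module A M]
    [Module.Finite A M] {t : ℕ} (h : maximalIdeal A ^ t ≤ Module.annihilator A M) :
    Module.supportDim A M ≤ (0 : ℕ) := by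
  have : Subsingleton (Module.support A M) := by
    have key (p : Module.support A M) : p.1.1 = maximalIdeal A := by
      have hp := Module.mem_support_iff_of_finite.mp p.2
      have := p.1.2
      exact le_antisymm (le_maximalIdeal p.1.2.ne_top) (p.1.2.le_of_pow_le (h.trans hp))
    exact ⟨fun p q ↦ Subtype.ext (PrimeSpectrum.ext ((key p).trans (key q).symm))⟩
  simpa [Module.supportDim] using Order.krullDim_nonpos_of_subsingleton

lemma exists_surjective_residueField {M : Type u} [AddCommGroup M] [Module A M]
    [Module.Finite A M] [Nontrivial M] : ∃ f : M →ₗ[A] ResidueField A, Function.Surjective f := by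
  obtain ⟨P, hP, -⟩ := (eq_top_or_exists_le_coatom (⊥ : Submodule A M)).resolve_left bot_ne_top
  have := isSimpleModule_iff_isCoatom.mpr hP
  obtain ⟨I, hI, ⟨e⟩⟩ := isSimpleModule_iff_quot_maximal.mp this
  obtain rfl := eq_maximalIdeal hI
  exact ⟨e.toLinearMap ∘ₗ P.mkQ, e.surjective.comp P.mkQ_surjective⟩

/-- `Extⁱ(k, N / xN)` sits between `Extⁱ(k, N)` and `Extⁱ⁺¹(k, N)`, so the depth bound drops by one.
-/
lemma subsingleton_ext_quotSMulTop {N : Type u} [AddCommGroup N] [Module A N]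
    {t : ℕ} (hN : ∀ i < t + 1, Subsingleton (ExtM A (ResidueField A) N i)) {x : A}
    (reg : IsSMulRegular N x) :
    ∀ i < t, Subsingleton (ExtM A (ResidueField A) (QuotSMulTop x N) i) := by
  refine fun i hi ↦ subsingleton_of_forall_eq 0 fun y ↦ ?_
  have h0 : reg.isShortExact.postδ (ResidueField A) i y = 0 :=
    (hN (i + 1) (by omega)).elim _ _
  obtain ⟨z, rfl⟩ := (reg.isShortExact.post_exact₃ i y).mp h0
  rw [(hN i (by omega)).elim z 0, map_zero]

namespace IsCanonicalModule

variable {ω : Type u} [AddCommGroup ω] [Module A ω] {d : ℕ}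

lemma ext_subsingleton (hω : IsCanonicalModule A ω) (hd : (d : WithBot ℕ∞) = ringKrullDim A)
    {i : ℕ} (hi : i ≠ d) : Subsingleton (ExtM A (ResidueField A) ω i) :=
  hω.ext_eq_zero i fun h ↦ hi (by rw [← hd] at h; exact_mod_cast h)

lemma ext_nontrivial (hω : IsCanonicalModule A ω) (hd : (d : WithBot ℕ∞) = ringKrullDim A) :
    Nontrivial (ExtM A (ResidueField A) ω d) :=
  (hω.ext_dim d hd).some.toEquiv.nontrivial

end IsCanonicalModule

variable [IsNoetherianRing A]

/-- If `B` is a cyclic module whose annihilator kills `N`, with `dim B ≤ t`, and `Extⁱ(k, N) = 0`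
for `i < t`, then every `B`-regular sequence is `N`-regular. -/
lemma isWeaklyRegular_of_cyclic {rs : List A} (hm : ∀ r ∈ rs, r ∈ maximalIdeal A)
    {B N : Type u} [AddCommGroup B] [Module A B] [Module.Finite A B]
    [AddCommGroup N] [Module A N] [Module.Finite A N] {t : ℕ}
    (hN : ∀ i < t, Subsingleton (ExtM A (ResidueField A) N i))
    (hdim : Module.supportDim A B ≤ t) (b : B) (hb : ∀ c : B, ∃ a : A, a • b = c)
    (hbN : ∀ w : N, ∃ f : B →ₗ[A] N, f b = w) (reg : IsWeaklyRegular B rs) :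
    IsWeaklyRegular N rs := by
  induction rs generalizing B N t with
  | nil => exact IsWeaklyRegular.nil A N
  | cons x rs ih =>
    rw [isWeaklyRegular_cons_iff] at reg ⊢
    obtain ⟨regx, reg⟩ := reg
    have hx : x ∈ maximalIdeal A := hm x (by simp)
    have hd := Module.supportDim_quotSMulTop_succ_eq_supportDim regx hx
    have hB : Subsingleton (QuotSMulTop x B) ∨
        ∃ c : ℕ, t = c + 1 ∧ Module.supportDim A (QuotSMulTop x B) ≤ c := by
      by_cases h : Subsingleton (QuotSMulTop x B)
      · exact Or.inl h
      · rw [← Module.supportDim_eq_bot_iff_subsingleton A] at h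
        exact Or.inr (exists_eq_add_one_of_add_one_le h (hd.trans_le hdim))
    -- `B / xB` is zero or has dimension less than `t`, so it has no nonzero map to `N`. If `x w =
    -- 0`, the map `B → N` with `b ↦ w` factors through `B / xB`, and so `w = 0`.
    have hHom : Subsingleton (ExtM A (QuotSMulTop x B) N 0) := by
      rcases hB with h | ⟨c, rfl, hc⟩
      · exact subsingleton_of_subsingleton_left 0
      · exact ext_subsingleton_of_supportDim_le hN c _ hc (by omega)
    have regN : IsSMulRegular N x := by
      refine (isSMulRegular_iff_right_eq_zero_of_smul ..).mpr fun w hw ↦ ?_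
      obtain ⟨f, rfl⟩ := hbN w
      have hf : x • (⊤ : Submodule A B) ≤ LinearMap.ker f := by
        rintro _ ⟨c, -, rfl⟩
        obtain ⟨a, rfl⟩ := hb c
        simp only [DistribSMul.toLinearMap_apply, LinearMap.mem_ker, map_smul]
        rw [hw, smul_zero]
      have h0 : (x • (⊤ : Submodule A B)).liftQ f hf = 0 :=
        zeroEquiv.symm.injective (hHom.elim _ _)
      simpa using LinearMap.congr_fun h0 (Submodule.Quotient.mk b)
    refine ⟨regN, ?_⟩
    have hbN' : ∀ w : QuotSMulTop x N, ∃ f : QuotSMulTop x B →ₗ[A] QuotSMulTop x N,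
        f (Submodule.Quotient.mk b) = w := by
      intro w
      obtain ⟨w, rfl⟩ := Submodule.Quotient.mk_surjective _ w
      obtain ⟨f, rfl⟩ := hbN w
      exact ⟨QuotSMulTop.map x f, rfl⟩
    have hb' : ∀ c : QuotSMulTop x B, ∃ a : A, a • Submodule.Quotient.mk b = c := by
      intro c
      obtain ⟨c, rfl⟩ := Submodule.Quotient.mk_surjective _ c
      obtain ⟨a, rfl⟩ := hb c
      exact ⟨a, rfl⟩
    have hm' : ∀ r ∈ rs, r ∈ maximalIdeal A := fun r hr ↦ hm r (by simp [hr])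
    -- If `B / xB = 0`, its dimension is `⊥`, so `t = 0` is an admissible bound and the vanishing
    -- condition is empty.
    rcases hB with h | ⟨c, rfl, hc⟩
    · refine ih hm' (t := 0) (by simp) ?_ _ hb' hbN' reg
      rw [(Module.supportDim_eq_bot_iff_subsingleton A _).mpr h]
      exact bot_le
    · exact ih hm' (subsingleton_ext_quotSMulTop hN regN) hc _ hb' hbN' reg

section Lifting

variable {ω : Type u} [AddCommGroup ω] [Module A ω] [Module.Finite A ω] {d : ℕ}

/-- If `Extⁱ(k, ω)` vanishes for `i > d` then `Extⁱ(M, ω)` vanishes for `i > d - r` if there is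
an `M`-regular sequence of length `r`. -/
lemma ext_subsingleton_of_lt_add_length
    (hω : ∀ i, d < i → Subsingleton (ExtM A (ResidueField A) ω i)) {rs : List A}
    (hm : ∀ r ∈ rs, r ∈ maximalIdeal A) {M : Type u} [AddCommGroup M] [Module A M]
    [Module.Finite A M] (reg : IsWeaklyRegular M rs) {i : ℕ} (hi : d < i + rs.length) :
    Subsingleton (ExtM A M ω i) := by
  induction rs generalizing M i with
  | nil => exact ext_subsingleton_of_lt hω M i (by simpa using hi)
  | cons x rs ih =>
    rw [isWeaklyRegular_cons_iff] at reg
    refine subsingleton_of_smul_surjective (hm x (by simp)) fun y ↦ ?_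
    have := ih (fun r hr ↦ hm r (by simp [hr])) reg.2 (i := i + 1)
      (by simp only [List.length_cons] at hi; omega)
    obtain ⟨z, hz⟩ := (reg.1.isShortExact.pre_exact₁ i y).mp (this.elim _ _)
    exact ⟨z, by rw [← hz, pre_smul, pre_id]⟩

/-- If `Extⁱ(k, ω)` vanishes for `i > d`, then composition with a nonzero element of `Extʳ(k, M)`,
where `r` is the length of an `M`-regular sequence, maps onto `Extᵈ(k, ω)`. -/
lemma exists_comp_eq
    (hω : ∀ i, d < i → Subsingleton (ExtM A (ResidueField A) ω i)) {rs : List A}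
    (hm : ∀ r ∈ rs, r ∈ maximalIdeal A) {M : Type u} [AddCommGroup M] [Module A M]
    [Module.Finite A M] (reg : IsWeaklyRegular M rs) {r j : ℕ} (hr : rs.length = r)
    (hj : r + j = d) {η : ExtM A (ResidueField A) M r} (hη : η ≠ 0)
    (c : ExtM A (ResidueField A) ω d) :
    ∃ ζ : ExtM A M ω j, Abelian.Ext.comp η ζ hj = c := by
  induction rs generalizing M r j with
  | nil =>
    obtain rfl : r = 0 := hr.symm
    obtain rfl : d = j := by omega
    obtain ⟨f, rfl⟩ := zeroEquiv.symm.surjective η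
    -- `k` is simple, so the nonzero `f` embeds it in `M`; then `Extᵈ(M, ω) → Extᵈ(k, ω)` is onto
    -- because `Extᵈ⁺¹` of the quotient vanishes.
    have hf : Function.Injective f :=
      (LinearMap.injective_or_eq_zero f).resolve_right fun h ↦ hη (by rw [h, map_zero])
    have hs : IsShortExact f (LinearMap.range f).mkQ :=
      ⟨hf, Submodule.mkQ_surjective _, fun x ↦ by simp⟩
    have := ext_subsingleton_of_lt hω (M ⧸ LinearMap.range f) (d + 1) (by omega)
    exact (hs.pre_exact₁ d c).mp (this.elim _ _)
  | cons x rs ih =>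
    obtain ⟨r, rfl⟩ : ∃ r', r = r' + 1 := ⟨rs.length, by simpa using hr.symm⟩
    have hreg := reg
    rw [isWeaklyRegular_cons_iff] at reg
    have hx : ∀ m : ResidueField A, x • m = 0 := by
      intro m
      rw [Algebra.smul_def, ResidueField.algebraMap_eq,
        (residue_eq_zero_iff x).mpr (hm x (by simp)), zero_mul]
    have h := reg.1.isShortExact
    -- As `x` kills `k`, `η` is the connecting image of some `η'` in `Extʳ(k, M / xM)`. The class
    -- `ζ` found for `η'` is a connecting image too, since `Extʲ⁺¹(M, ω) = 0`, and associativity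
    -- moves the extension class from one factor to the other.
    have h0 : post (ResidueField A) (x • LinearMap.id : M →ₗ[A] M) (r + 1) η = 0 := by
      rw [post_smul, post_id, smul_eq_zero_of_annihilator_left hx]
    obtain ⟨η', rfl⟩ := (h.post_exact₁ r η).mp h0
    have hη' : η' ≠ 0 := fun h ↦ hη (by rw [h, map_zero])
    obtain ⟨ζ, hζ⟩ := ih (fun r hr ↦ hm r (by simp [hr])) reg.2 (r := r) (j := j + 1)
      (by simpa using hr) (by omega) hη'
    have hM := ext_subsingleton_of_lt_add_length hω hm hreg (i := j + 1) (by rw [hr]; omega)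
    obtain ⟨ζ', rfl⟩ := (h.pre_exact₃ j ζ).mp (hM.elim _ _)
    refine ⟨ζ', ?_⟩
    rw [← hζ, IsShortExact.postδ_apply, IsShortExact.preδ_apply]
    exact Abelian.Ext.comp_assoc _ _ _ _ _ (by omega)

end Lifting

namespace IsCanonicalModule

variable {ω ω' : Type u} [AddCommGroup ω] [Module A ω] [AddCommGroup ω'] [Module A ω'] {d : ℕ}

/-- The case `B = A`, `t = dim A` of `isWeaklyRegular_of_cyclic`: elements of `ω` are maps `A → ω`.
-/
lemma isWeaklyRegular (hω : IsCanonicalModule A ω) (hd : (d : WithBot ℕ∞) = ringKrullDim A)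
    {rs : List A} (hm : ∀ r ∈ rs, r ∈ maximalIdeal A) (reg : IsWeaklyRegular A rs) :
    IsWeaklyRegular ω rs := by
  have := hω.finite
  refine isWeaklyRegular_of_cyclic hm (B := A) (t := d)
    (fun i hi ↦ hω.ext_subsingleton hd hi.ne) ?_ 1 (fun c ↦ ⟨c, by simp⟩)
    (fun w ↦ ⟨LinearMap.toSpanSingleton A ω w, by simp⟩) reg
  rw [Module.supportDim_self_eq_ringKrullDim, hd]

/-- Nonzerodivisors are regular on a canonical module. -/
lemma isSMulRegular (hω : IsCanonicalModule A ω) (hd : (d : WithBot ℕ∞) = ringKrullDim A)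
    {x : A} (hx : IsSMulRegular A x) : IsSMulRegular ω x := by
  by_cases hxm : x ∈ maximalIdeal A
  · rw [← isWeaklyRegular_singleton_iff] at hx ⊢
    exact hω.isWeaklyRegular hd (by simpa using hxm) hx
  · exact ((not_not.mp hxm : IsUnit x)).isSMulRegular ω

/-- Canonical modules of a Cohen–Macaulay local ring are isomorphic. -/
theorem nonempty_linearEquiv (hA : IsCohenMacaulayLocal A) (hω : IsCanonicalModule A ω)
    (hω' : IsCanonicalModule A ω') : Nonempty (ω' ≃ₗ[A] ω) := by
  obtain ⟨-, rs, hm, reg, hd⟩ := hA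
  have := hω.finite
  have := hω'.finite
  have nt := hω.ext_nontrivial hd
  have nt' := hω'.ext_nontrivial hd
  obtain ⟨η, hη⟩ := exists_ne (0 : ExtM A (ResidueField A) ω' rs.length)
  obtain ⟨c, hc⟩ := exists_ne (0 : ExtM A (ResidueField A) ω rs.length)
  -- An `A`-regular sequence of length `dim A` is `ω'`-regular, so here `j = 0` and the class `ζ` is
  -- a homomorphism.
  obtain ⟨ζ, hζ⟩ := exists_comp_eq (d := rs.length)
    (fun i hi ↦ hω.ext_subsingleton hd hi.ne') hm
    (hω'.isWeaklyRegular hd hm reg.toIsWeaklyRegular) rfl (add_zero _) hη c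
  obtain ⟨f, rfl⟩ := zeroEquiv.symm.surjective ζ
  have hf : post (ResidueField A) f rs.length η = c := hζ
  refine ⟨LinearEquiv.ofBijective f (bijective_of_residueField f fun i ↦ ?_)⟩
  by_cases hi : i = rs.length
  · subst hi
    have s : IsSimpleModule A (ExtM A (ResidueField A) ω rs.length) :=
      IsSimpleModule.congr (hω.ext_dim _ hd).some
    have s' : IsSimpleModule A (ExtM A (ResidueField A) ω' rs.length) :=
      IsSimpleModule.congr (hω'.ext_dim _ hd).some
    refine (LinearMap.bijective_or_eq_zero _).resolve_right fun h0 ↦ hc ?_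
    rw [← hf, h0, LinearMap.zero_apply]
  · have s := hω.ext_subsingleton hd hi
    have s' := hω'.ext_subsingleton hd hi
    exact ⟨Function.injective_of_subsingleton _, fun y ↦ ⟨0, Subsingleton.elim _ _⟩⟩

/-- The preceding term `Ext^{d-1}(M₁, ω)` vanishes since `dim M₁ ≤ 0`; for `d = 0` this is left
exactness of `Hom`. -/
lemma pre_injective (hω : IsCanonicalModule A ω) (hd : (d : WithBot ℕ∞) = ringKrullDim A)
    {M₁ M₂ M₃ : Type u} [AddCommGroup M₁] [Module A M₁] [Module.Finite A M₁] [AddCommGroup M₂]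
    [Module A M₂] [AddCommGroup M₃] [Module A M₃] {f : M₁ →ₗ[A] M₂} {g : M₂ →ₗ[A] M₃}
    (h : IsShortExact f g) (h₁ : Module.supportDim A M₁ ≤ (0 : ℕ)) :
    Function.Injective (pre g ω d) := by
  have := hω.finite
  match d with
  | 0 => exact h.pre_injective_zero
  | d + 1 =>
    refine (injective_iff_map_eq_zero _).mpr fun x hx ↦ ?_
    obtain ⟨y, rfl⟩ := (h.pre_exact₃ d x).mp hx
    have := ext_subsingleton_of_supportDim_le (t := d + 1) (N := ω)
      (fun i hi ↦ hω.ext_subsingleton hd hi.ne) 0 M₁ h₁ (i := d) (by omega)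
    rw [this.elim y 0, map_zero]

/-- A canonical module is faithful. -/
theorem eq_zero_of_smul (hω : IsCanonicalModule A ω) (hd : (d : WithBot ℕ∞) = ringKrullDim A)
    {r : A} (hr : ∀ w : ω, r • w = 0) : r = 0 := by
  have := hω.finite
  -- Krull's intersection theorem.
  suffices H : ∀ t : ℕ, r ∈ maximalIdeal A ^ t by
    have h0 := Ideal.iInf_pow_eq_bot_of_isLocalRing (maximalIdeal A) (Ideal.IsPrime.ne_top')
    rw [← Ideal.mem_bot, ← h0]
    exact (Submodule.mem_iInf _).mpr H
  intro t
  by_contra hrt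
  let N := A ⧸ maximalIdeal A ^ t
  have hdim (M : Type u) [AddCommGroup M] [Module A M] [Module.Finite A M] (f : M →ₗ[A] N)
      (hf : Function.Injective f) : Module.supportDim A M ≤ (0 : ℕ) :=
    (Module.supportDim_le_of_injective f hf).trans
      (supportDim_nonpos_of_maximalIdeal_pow_le (Ideal.annihilator_quotient).ge)
  -- Multiplication by `r` factors as `N ↠ rN ↪ N`. On `Extᵈ(-, ω)` the inclusion induces a
  -- surjection and the projection an injection, while the composite is `r = 0`; so `Extᵈ(rN, ω) =
  -- 0`. But `rN ≠ 0` maps onto `k`, so `Extᵈ(k, ω)` embeds in it, a contradiction.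
  let ρ : N →ₗ[A] N := r • LinearMap.id
  have : Nontrivial (LinearMap.range ρ) := by
    rw [Submodule.nontrivial_iff_ne_bot, ne_eq, LinearMap.range_eq_bot]
    intro h
    apply hrt
    have := LinearMap.congr_fun h (Ideal.Quotient.mk _ 1)
    rw [← Ideal.Quotient.eq_zero_iff_mem]
    simpa [ρ, N, Algebra.smul_def] using this
  have h₁ := isShortExact_mkQ (LinearMap.range ρ)
  have h₂ := isShortExact_ker ρ.surjective_rangeRestrict
  have hs : Subsingleton (ExtM A (LinearMap.range ρ) ω d) := by
    refine subsingleton_of_forall_eq 0 fun y ↦ ?_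
    have := ext_subsingleton_of_lt (N := ω) (fun i hi ↦ hω.ext_subsingleton hd hi.ne')
      (N ⧸ LinearMap.range ρ) (d + 1) (by omega)
    obtain ⟨x, rfl⟩ := (h₁.pre_exact₁ d y).mp (this.elim _ _)
    refine hω.pre_injective hd h₂ (hdim _ _ (Submodule.subtype_injective _)) ?_
    rw [map_zero, ← pre_comp,
      show (LinearMap.range ρ).subtype ∘ₗ ρ.rangeRestrict = r • LinearMap.id from rfl, pre_smul,
      pre_id]
    exact smul_eq_zero_of_annihilator_right hr d x
  obtain ⟨f, hf⟩ := exists_surjective_residueField (A := A) (M := LinearMap.range ρ)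
  have inj := hω.pre_injective hd (isShortExact_ker hf)
    (hdim _ ((LinearMap.range ρ).subtype ∘ₗ (LinearMap.ker f).subtype)
      (Subtype.val_injective.comp Subtype.val_injective))
  have nt := hω.ext_nontrivial hd
  exact not_subsingleton _ inj.subsingleton

end IsCanonicalModule

end CanonicalModule

/-! ### Regular local rings and `Ext(k, S)` -/

section RegularLocal

open ExtM Pointwise RingTheory.Sequence

/-- The `Ext` modules into `C` of the quotient of `M` by an `M`-regular sequence, if the `Ext`
modules of `M` are concentrated in one degree, where they are isomorphic to `M`. -/
lemma ext_quotient_ofList {A C M : Type u} [CommRing A] [AddCommGroup C] [Module A C]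
    [AddCommGroup M] [Module A M] {rs : List A} (reg : IsWeaklyRegular M rs) {j : ℕ}
    (h0 : ∀ i, i ≠ j → Subsingleton (ExtM A M C i)) (hj : Nonempty (ExtM A M C j ≃ₗ[A] M)) :
    (∀ i, i ≠ j + rs.length →
      Subsingleton (ExtM A (M ⧸ (Ideal.ofList rs • ⊤ : Submodule A M)) C i)) ∧
    Nonempty (ExtM A (M ⧸ (Ideal.ofList rs • ⊤ : Submodule A M)) C (j + rs.length) ≃ₗ[A]
      (M ⧸ (Ideal.ofList rs • ⊤ : Submodule A M))) := by
  induction rs generalizing M j with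
  | nil =>
    let e : (M ⧸ (Ideal.ofList ([] : List A) • ⊤ : Submodule A M)) ≃ₗ[A] M :=
      Submodule.quotEquivOfEqBot _ (by simp)
    refine ⟨fun i hi ↦ ?_, ?_⟩
    · have := h0 i (by simpa using hi)
      exact (congrLeft e C i).toEquiv.subsingleton
    · obtain ⟨f⟩ := hj
      exact ⟨(congrLeft e C j).trans (f.trans e.symm)⟩
  | cons x rs ih =>
    rw [isWeaklyRegular_cons_iff] at reg
    obtain ⟨regx, reg⟩ := reg
    have h := regx.isShortExact
    obtain ⟨f⟩ := hj
    have regE : IsSMulRegular (ExtM A M C j) x := (f.isSMulRegular_congr x).mpr regx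
    have hpre (i : ℕ) (y : ExtM A M C i) :
        pre (x • LinearMap.id : M →ₗ[A] M) C i y = x • y := by rw [pre_smul, pre_id]
    have h0' : ∀ i, i ≠ j + 1 → Subsingleton (ExtM A (QuotSMulTop x M) C i) := by
      refine fun i hi ↦ subsingleton_of_forall_eq 0 fun y ↦ ?_
      have hy : pre (x • (⊤ : Submodule A M)).mkQ C i y = 0 := by
        by_cases hij : i = j
        · subst hij
          apply regE
          simp only [← hpre, map_zero]
          exact (h.pre_exact₂ i).apply_apply_eq_zero y
        · exact (h0 i hij).elim _ _
      match i with
      | 0 => exact h.pre_injective_zero (hy.trans (map_zero _).symm)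
      | i + 1 =>
        obtain ⟨z, rfl⟩ := (h.pre_exact₃ i y).mp hy
        rw [(h0 i (by omega)).elim z 0, map_zero]
    have hsurj : Function.Surjective (h.preδ C j) := fun y ↦
      (h.pre_exact₃ j y).mp ((h0 (j + 1) (by omega)).elim _ _)
    -- The connecting map is onto with kernel `x Extʲ(M, C)`, so `Extʲ⁺¹(M / xM, C) ≅ M / xM` and
    -- the induction continues in degree `j + 1`.
    have hker : LinearMap.ker (h.preδ C j) = x • (⊤ : Submodule A (ExtM A M C j)) := by
      ext y
      rw [LinearMap.mem_ker, h.pre_exact₁ j y, Submodule.mem_smul_pointwise_iff_exists]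
      simp [hpre]
    let f' : ExtM A (QuotSMulTop x M) C (j + 1) ≃ₗ[A] QuotSMulTop x M :=
      ((h.preδ C j).quotKerEquivOfSurjective hsurj).symm.trans
        ((Submodule.quotEquivOfEq _ _ hker).trans (QuotSMulTop.congr x f))
    obtain ⟨h1, ⟨h2⟩⟩ := ih reg h0' ⟨f'⟩
    let e := Submodule.quotOfListConsSMulTopEquivQuotSMulTopInner M x rs
    have hl : j + (x :: rs).length = j + 1 + rs.length := by simp; omega
    rw [hl]
    refine ⟨fun i hi ↦ ?_, ?_⟩
    · have := h1 i hi
      exact (congrLeft e C i).toEquiv.subsingleton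
    · exact ⟨(congrLeft e C _).trans (h2.trans e.symm)⟩

/-- In a local ring, an element of `span s` not in `m²` can replace one of the generators. -/
lemma exists_span_insert_erase {S : Type*} [CommRing S] [IsLocalRing S] {s : Finset S}
    (hs : Ideal.span (s : Set S) = maximalIdeal S) {x : S} (hx : x ∈ maximalIdeal S)
    (hx2 : x ∉ maximalIdeal S ^ 2) [DecidableEq S] :
    ∃ y ∈ s, Ideal.span {x} ⊔ Ideal.span ((s.erase y : Finset S) : Set S) = maximalIdeal S := by
  rw [← hs] at hx
  obtain ⟨a, -, ha⟩ := Submodule.mem_span_finset.mp hx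
  obtain ⟨y, hy, hay⟩ : ∃ y ∈ s, IsUnit (a y) := by
    by_contra! hc
    apply hx2
    rw [← ha, pow_two]
    exact Submodule.sum_mem _ fun y hy ↦ Ideal.mul_mem_mul (hc y hy)
      (hs ▸ Ideal.subset_span hy)
  refine ⟨y, hy, le_antisymm (sup_le ?_ ?_) ?_⟩
  · rw [Ideal.span_singleton_le_iff_mem, ← hs]
    exact hx
  · rw [← hs]
    exact Ideal.span_mono (by simp)
  · rw [← hs, Ideal.span_le]
    intro z hz
    by_cases hzy : z = y
    · subst hzy
      obtain ⟨u, hu⟩ := hay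
      have h1 : x - ∑ w ∈ s.erase z, a w • w = u • z := by
        rw [← ha, ← Finset.add_sum_erase s _ hy, add_sub_cancel_right, ← hu]
        rfl
      have h2 : z = (↑u⁻¹ : S) * (x - ∑ w ∈ s.erase z, a w • w) := by
        rw [h1, Units.smul_def, smul_eq_mul, Units.inv_mul_cancel_left]
      have h3 : (↑u⁻¹ : S) * (x - ∑ w ∈ s.erase z, a w • w) ∈
          Ideal.span {x} ⊔ Ideal.span ((s.erase z : Finset S) : Set S) :=
        Ideal.mul_mem_left _ _ (sub_mem (Ideal.mem_sup_left (Ideal.mem_span_singleton_self x))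
          (Ideal.mem_sup_right (Submodule.sum_mem _ fun w hw ↦
            Ideal.mul_mem_left _ _ (Ideal.subset_span hw))))
      rwa [← h2] at h3
    · exact Ideal.mem_sup_right (Ideal.subset_span (by simp [hzy, Finset.mem_coe.mp hz]))

/-- Prime avoidance: in positive dimension the maximal ideal lies neither in its square, by
Nakayama, nor in a minimal prime, by height. -/
lemma IsRegularLocalRing.exists_mem_notMem {S : Type u} [CommRing S] [IsRegularLocalRing S]
    {n : ℕ} (hn : ringKrullDim S = (n + 1 : ℕ)) :
    ∃ x ∈ maximalIdeal S, x ∉ maximalIdeal S ^ 2 ∧ ∀ p ∈ minimalPrimes S, x ∉ p := by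
  by_contra! h
  have hsub : ((maximalIdeal S : Ideal S) : Set S) ⊆
      ⋃ i ∈ insert (maximalIdeal S ^ 2) (minimalPrimes S), ((id i : Ideal S) : Set S) := by
    intro x hx
    simp only [Set.mem_iUnion, exists_prop]
    by_cases hx2 : x ∈ maximalIdeal S ^ 2
    · exact ⟨_, Set.mem_insert _ _, hx2⟩
    · obtain ⟨p, hp, hxp⟩ := h x hx hx2
      exact ⟨p, Set.mem_insert_of_mem _ hp, hxp⟩
  -- The square of the maximal ideal fills both slots in which prime avoidance tolerates a non-prime
  -- ideal.
  rw [Ideal.subset_union_prime_finite ((minimalPrimes.finite_of_isNoetherianRing S).insert _)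
    (maximalIdeal S ^ 2) (maximalIdeal S ^ 2)] at hsub
  · obtain ⟨p, hp, hle⟩ := hsub
    have hdim := IsLocalRing.maximalIdeal_height_eq_ringKrullDim (R := S)
    rw [hn] at hdim
    rcases hp with rfl | hp
    · have h0 : maximalIdeal S = ⊥ := by
        refine Submodule.eq_bot_of_le_smul_of_le_jacobson_bot (maximalIdeal S) _
          (IsNoetherian.noetherian _) ?_ (IsLocalRing.maximalIdeal_le_jacobson _)
        simpa [pow_two] using hle
      rw [h0, Ideal.height_bot] at hdim
      exact absurd (by exact_mod_cast hdim : (0 : ℕ) = n + 1) (by omega)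
    · have hp' := hp.isPrime
      have : (maximalIdeal S).height ≤ p.height := Ideal.height_mono hle
      rw [Ideal.height_eq_zero_iff.mpr hp, nonpos_iff_eq_zero] at this
      rw [this] at hdim
      exact absurd (by exact_mod_cast hdim : (0 : ℕ) = n + 1) (by omega)
  · rintro p (rfl | hp) h1 -
    · exact absurd rfl h1
    · exact hp.isPrime

/-- A regular local ring is a domain, and its maximal ideal is generated by a regular sequence. -/
theorem IsRegularLocalRing.isDomain_and_exists_isWeaklyRegular (n : ℕ) (S : Type u) [CommRing S]
    [IsRegularLocalRing S] (hn : ringKrullDim S = n) :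
    IsDomain S ∧ ∃ rs : List S, IsWeaklyRegular S rs ∧ Ideal.ofList rs = maximalIdeal S ∧
      rs.length = n := by
  induction n generalizing S with
  | zero =>
    have h := (isRegularLocalRing_iff S).mp inferInstance
    rw [hn] at h
    have h' : (maximalIdeal S).spanFinrank = 0 := by exact_mod_cast h
    rw [Submodule.spanFinrank_eq_zero_iff_eq_bot (IsNoetherian.noetherian _)] at h'
    have hf : IsField S := IsLocalRing.isField_iff_maximalIdeal_eq.mpr h'
    exact ⟨hf.isDomain, [], IsWeaklyRegular.nil _ _, by simp [h'], rfl⟩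
  | succ n ih =>
    classical
    have hfr := (isRegularLocalRing_iff S).mp inferInstance
    rw [hn] at hfr
    have hfr' : (maximalIdeal S).spanFinrank = n + 1 := by exact_mod_cast hfr
    obtain ⟨x, hx, hx2, hxp⟩ := IsRegularLocalRing.exists_mem_notMem hn
    obtain ⟨s, hs, hspan⟩ := Submodule.FG.exists_span_finset_card_eq_spanFinrank
      (IsNoetherian.noetherian (maximalIdeal S))
    obtain ⟨y, hy, hxy⟩ := exists_span_insert_erase hspan hx hx2
    let S' := S ⧸ Ideal.span {x}
    have hxtop : Ideal.span {x} ≠ ⊤ := by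
      rw [ne_eq, Ideal.span_singleton_eq_top]
      exact hx
    have : Nontrivial S' := Ideal.Quotient.nontrivial_iff.mpr hxtop
    have : IsLocalRing S' := IsLocalRing.of_surjective' (Ideal.Quotient.mk _)
      Ideal.Quotient.mk_surjective
    have hmap : (maximalIdeal S).map (Ideal.Quotient.mk (Ideal.span {x})) = maximalIdeal S' :=
      IsLocalRing.map_maximalIdeal_of_surjective _ Ideal.Quotient.mk_surjective
    have hgen : maximalIdeal S' =
        Ideal.span (((s.erase y).image (Ideal.Quotient.mk (Ideal.span {x})) : Finset S') : Set S') := by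
      rw [← hmap, ← hxy, Ideal.map_sup, Ideal.map_span, Ideal.map_span, Finset.coe_image]
      simp [Ideal.Quotient.eq_zero_iff_mem.mpr (Ideal.mem_span_singleton_self x)]
      rfl
    -- At most `n` generators and, below, dimension at least `n`: so `S / x` is regular of dimension
    -- `n`.
    have hle : (maximalIdeal S').spanFinrank ≤ n := by
      rw [hgen]
      refine (Submodule.spanFinrank_span_le_ncard_of_finite (Finset.finite_toSet _)).trans ?_
      rw [Set.ncard_coe_finset]
      refine Finset.card_image_le.trans ?_
      rw [Finset.card_erase_of_mem hy]
      omega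
    have hdim : (n : WithBot ℕ∞) ≤ ringKrullDim S' := by
      have h1 := ringKrullDim_le_ringKrullDim_quotSMulTop_succ hx
      have hs : Ideal.span {x} = x • (⊤ : Ideal S) := by
        simp [← Submodule.ideal_span_singleton_smul]
      rw [← hs, hn] at h1
      have h2 : (n : WithBot ℕ∞) + 1 ≤ ringKrullDim S' + 1 := by exact_mod_cast h1
      exact (ENat.WithBot.add_le_add_one_right_iff).mp h2
    have hreg : IsRegularLocalRing S' :=
      IsRegularLocalRing.of_spanFinrank_maximalIdeal_le S'
        (le_trans (by exact_mod_cast hle) hdim)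
    have hdim' : ringKrullDim S' = n := by
      refine le_antisymm ?_ hdim
      rw [← (isRegularLocalRing_iff S').mp hreg]
      exact_mod_cast hle
    obtain ⟨hdom, rs', hrs', hof, hlen⟩ := ih S' hdim'
    have hprime : (Ideal.span {x}).IsPrime := (Ideal.Quotient.isDomain_iff_prime _).mp hdom
    obtain ⟨p, hp, hpx⟩ := Ideal.exists_minimalPrimes_le (bot_le : ⊥ ≤ Ideal.span {x})
    have hp' := hp.isPrime
    -- Elements of `p ⊆ (x)` have the form `x a`, and `x ∉ p` gives `a ∈ p`; thus `p = x p`, and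
    -- Nakayama applies.
    have hp0 : p = ⊥ := by
      refine Submodule.eq_bot_of_le_smul_of_le_jacobson_bot (Ideal.span {x}) p
        (IsNoetherian.noetherian _) (fun q hq ↦ ?_)
        ((Ideal.span_singleton_le_iff_mem _).mpr (IsLocalRing.maximalIdeal_le_jacobson _ hx))
      obtain ⟨a, rfl⟩ := Ideal.mem_span_singleton.mp (hpx hq)
      exact Ideal.mul_mem_mul (Ideal.mem_span_singleton_self x)
        ((hp'.mem_or_mem hq).resolve_left (hxp p hp))
    have hS : IsDomain S := by
      subst hp0
      exact IsDomain.of_bot_isPrime S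
    refine ⟨hS, ?_⟩
    have hx0 : x ≠ 0 := fun h ↦ hxp p hp (h ▸ zero_mem _)
    obtain ⟨rs, rfl⟩ : ∃ rs : List S, rs.map (algebraMap S S') = rs' :=
      List.map_surjective_iff.mpr Ideal.Quotient.mk_surjective rs'
    refine ⟨x :: rs, ?_, ?_, by simpa using hlen⟩
    · rw [isWeaklyRegular_cons_iff]
      refine ⟨fun a b hab ↦ mul_left_cancel₀ hx0 hab, ?_⟩
      rw [isWeaklyRegular_map_algebraMap_iff] at hrs'
      have hs : x • (⊤ : Ideal S) = Ideal.span {x} := by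
        simp [← Submodule.ideal_span_singleton_smul]
      exact ((Submodule.quotEquivOfEq _ _ hs).isWeaklyRegular_congr rs).mpr hrs'
    · rw [Ideal.ofList_cons, sup_comm]
      have h1 : (Ideal.ofList rs).map (Ideal.Quotient.mk (Ideal.span {x})) = maximalIdeal S' := by
        rw [← hof, Ideal.map_ofList]
        rfl
      have h2 := congrArg (Ideal.comap (Ideal.Quotient.mk (Ideal.span {x}))) h1
      rw [Ideal.comap_map_of_surjective' _ Ideal.Quotient.mk_surjective, Ideal.mk_ker] at h2
      rw [h2, ← hmap, Ideal.comap_map_of_surjective' _ Ideal.Quotient.mk_surjective, Ideal.mk_ker]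
      exact sup_eq_left.mpr ((Ideal.span_singleton_le_iff_mem _).mpr hx)

/-- The modules `Extⁱ(k, S)` for a regular local ring `S`. -/
theorem IsRegularLocalRing.ext_residueField {S : Type u} [CommRing S] [IsRegularLocalRing S]
    {n : ℕ} (hn : ringKrullDim S = n) :
    (∀ i, i ≠ n → Subsingleton (ExtM S (ResidueField S) S i)) ∧
      Nonempty (ExtM S (ResidueField S) S n ≃ₗ[S] ResidueField S) := by
  obtain ⟨-, rs, reg, hof, hlen⟩ :=
    IsRegularLocalRing.isDomain_and_exists_isWeaklyRegular n S hn
  obtain ⟨h1, ⟨h2⟩⟩ := ext_quotient_ofList (C := S) reg (j := 0)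
    (fun i hi ↦ by
      obtain ⟨i, rfl⟩ := Nat.exists_eq_succ_of_ne_zero hi
      exact subsingleton_of_projective i)
    ⟨zeroEquiv.trans (LinearMap.ringLmapEquivSelf S S S)⟩
  rw [zero_add, hlen] at h1 h2
  let e : (S ⧸ (Ideal.ofList rs • ⊤ : Submodule S S)) ≃ₗ[S] ResidueField S :=
    Submodule.quotEquivOfEq _ (maximalIdeal S) (by simp [hof])
  refine ⟨fun i hi ↦ ?_, ⟨(congrLeft e.symm S n).trans (h2.trans e)⟩⟩
  have := h1 i hi
  exact (congrLeft e.symm S i).toEquiv.subsingleton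

end RegularLocal

/-! ### Dimension of `S / I` and `Ext` along the resolution -/

section Dimension

open ExtM

/-- In a chain of primes over `I` realizing `dim S / I`, the `i`-th prime has height at least `g +
i`. -/
lemma height_add_ringKrullDim_quotient_le {S : Type*} [CommRing S] {I : Ideal S} {g d n : ℕ}
    (hg : I.height = g) (hd : ringKrullDim (S ⧸ I) = d) (hn : ringKrullDim S = n) :
    g + d ≤ n := by
  rw [ringKrullDim_quotient] at hd
  obtain ⟨p, hp⟩ := Order.le_krullDim_iff.mp hd.ge
  have key (i : ℕ) (hi : i < p.length + 1) :
      ((g + i : ℕ) : ℕ∞) ≤ (p ⟨i, hi⟩).1.asIdeal.height := by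
    induction i with
    | zero =>
      rw [add_zero, ← hg]
      exact Ideal.height_mono (p ⟨0, hi⟩).2
    | succ i ih =>
      have hlt : (p ⟨i, by omega⟩).1.asIdeal < (p ⟨i + 1, hi⟩).1.asIdeal :=
        p.strictMono (Fin.mk_lt_mk.mpr i.lt_succ_self)
      refine le_trans ?_ (Ideal.height_add_one_le_of_lt_of_isPrime hlt)
      rw [← add_assoc, Nat.cast_succ]
      gcongr
      exact ih _
  have h1 := key p.length (by omega)
  have h2 := (WithBot.coe_le_coe.mpr h1).trans
    (Ideal.height_le_ringKrullDim_of_isPrime (I := (p ⟨p.length, by omega⟩).1.asIdeal))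
  rw [hn, hp] at h2
  exact_mod_cast h2

lemma supportDim_le_ringKrullDim_quotient {S : Type u} [CommRing S] {I : Ideal S} {M : Type u}
    [AddCommGroup M] [Module S M] [Module.Finite S M] (h : I ≤ Module.annihilator S M) :
    Module.supportDim S M ≤ ringKrullDim (S ⧸ I) := by
  rw [Module.supportDim_eq_ringKrullDim_quotient_annihilator]
  exact ringKrullDim_le_of_surjective _ (Ideal.Quotient.factor_surjective h)

end Dimension

namespace MinimalFreeResolution

open ExtM

variable {S : Type u} [CommRing S] [IsLocalRing S] {I : Ideal S} {g : ℕ}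
  (G : MinimalFreeResolution I g)

/-- The `(j + 1)`-st syzygy module of a free resolution. -/
abbrev syz (j : ℕ) : Submodule S (Fin (G.rank j) → S) := LinearMap.range (G.d j).mulVecLin

lemma isShortExact_zero : IsShortExact (G.syz 0).subtype G.augmentation where
  injective := Subtype.val_injective
  surjective := G.augmentation_surjective
  exact x := by rw [G.exact_zero x]; simp

lemma isShortExact_succ (j : ℕ) :
    IsShortExact (G.syz (j + 1)).subtype (G.d j).mulVecLin.rangeRestrict where
  injective := Subtype.val_injective
  surjective := LinearMap.surjective_rangeRestrict _
  exact x := by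
    have := G.exact_succ j x
    rw [← Subtype.coe_inj, LinearMap.codRestrict_apply, ZeroMemClass.coe_zero, this]
    simp

lemma subsingleton_syz {j : ℕ} (hj : g ≤ j) : Subsingleton (G.syz j) := by
  have : IsEmpty (Fin (G.rank (j + 1))) := by
    rw [G.rank_eq_zero (j + 1) (by omega)]
    infer_instance
  exact (LinearMap.surjective_rangeRestrict (G.d j).mulVecLin).subsingleton

/-- Depth counting: free modules have no `Extⁱ(k, -)` for `i < n`, so `Extⁱ(k, syz j)` embeds in
`Extⁱ⁺¹(k, syz (j + 1))` until the syzygies vanish. The parameter `t` bounds the steps left. -/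
lemma ext_residueField_syz {n : ℕ} (hS : ∀ i < n, Subsingleton (ExtM S (ResidueField S) S i))
    (t : ℕ) : ∀ i j : ℕ, g ≤ j + t → i + g < n + j + 1 →
      Subsingleton (ExtM S (ResidueField S) (G.syz j) i) := by
  have triv (i j : ℕ) (hj : g ≤ j) : Subsingleton (ExtM S (ResidueField S) (G.syz j) i) := by
    have := G.subsingleton_syz hj
    refine subsingleton_of_forall_eq 0 fun x ↦ ?_
    rw [← one_smul S x]
    exact smul_eq_zero_of_annihilator_right (fun m ↦ Subsingleton.elim _ _) i x
  induction t with
  | zero => exact fun i j hj _ ↦ triv i j (by omega)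
  | succ t ih =>
    intro i j hj hi
    by_cases hgj : g ≤ j
    · exact triv i j hgj
    have h := G.isShortExact_succ j
    have h1 := ih (i + 1) (j + 1) (by omega) (by omega)
    have h2 := subsingleton_pi_right (n := G.rank (j + 1)) (hS i (by omega))
    refine subsingleton_of_forall_eq 0 fun x ↦ ?_
    obtain ⟨y, rfl⟩ := (h.post_exact₃ i x).mp (h1.elim _ _)
    rw [h2.elim y 0, map_zero]

lemma ext_residueField_quotient (G : MinimalFreeResolution I g) {n : ℕ}
    (hS : ∀ i < n, Subsingleton (ExtM S (ResidueField S) S i)) {i : ℕ} (hi : i + g < n) :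
    Subsingleton (ExtM S (ResidueField S) (S ⧸ I) i) := by
  have h := G.isShortExact_zero
  have h1 := G.ext_residueField_syz hS g (i + 1) 0 (by omega) (by omega)
  have h2 := subsingleton_pi_right (n := G.rank 0) (hS i (by omega))
  refine subsingleton_of_forall_eq 0 fun x ↦ ?_
  obtain ⟨y, rfl⟩ := (h.post_exact₃ i x).mp (h1.elim _ _)
  rw [h2.elim y 0, map_zero]

/-- The dimension of `S / I` is at least `dim S - g` if `S / I` has a free resolution of
length `g`. -/
lemma le_add_of_ringKrullDim_quotient (G : MinimalFreeResolution I g)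
    [IsNoetherianRing S] {n d : ℕ}
    (hS : ∀ i < n, Subsingleton (ExtM S (ResidueField S) S i))
    (hd : ringKrullDim (S ⧸ I) = d) : n ≤ g + d := by
  -- Otherwise `Extⁱ(k, S / I) = 0` for all `i ≤ dim S / I`, which makes the identity of `S / I`
  -- zero.
  by_contra! hlt
  have h := ext_subsingleton_of_supportDim_le (A := S) (N := S ⧸ I) (t := d + 1)
    (fun i hi ↦ G.ext_residueField_quotient hS (by omega)) d (S ⧸ I)
    (by rw [Module.supportDim_quotient_eq_ringKrullDim, hd]) (i := 0) (by omega)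
  have hid : (LinearMap.id : (S ⧸ I) →ₗ[S] (S ⧸ I)) = 0 := zeroEquiv.symm.injective (h.elim _ _)
  have hs : Subsingleton (S ⧸ I) := subsingleton_of_forall_eq 0 fun x ↦ LinearMap.congr_fun hid x
  have := ringKrullDim_eq_bot_of_subsingleton (R := S ⧸ I)
  rw [hd] at this
  exact WithBot.natCast_ne_bot d this

/-- For `j < g` the module `syz j` has a free resolution of length `g - j - 1`. -/
lemma ext_syz_subsingleton (C : Type u) [AddCommGroup C] [Module S C] (i : ℕ) :
    ∀ j : ℕ, g ≤ i + j → Subsingleton (ExtM S (G.syz j) C i) := by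
  induction i with
  | zero =>
    intro j hj
    have := G.subsingleton_syz (j := j) (by omega)
    exact subsingleton_of_subsingleton_left 0
  | succ i ih =>
    intro j hj
    refine subsingleton_of_forall_eq 0 fun x ↦ ?_
    have := subsingleton_of_projective (A := S) (M := Fin (G.rank (j + 1)) → S) (N := C) i
    obtain ⟨y, rfl⟩ := ((G.isShortExact_succ j).pre_exact₃ i x).mp (this.elim _ _)
    rw [(ih (j + 1) (by omega)).elim y 0, map_zero]

lemma ext_quotient_subsingleton (G : MinimalFreeResolution I g) (C : Type u) [AddCommGroup C]
    [Module S C] {i : ℕ} (hi : g < i) :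
    Subsingleton (ExtM S (S ⧸ I) C i) := by
  obtain ⟨i, rfl⟩ : ∃ i', i = i' + 1 := ⟨i - 1, by omega⟩
  refine subsingleton_of_forall_eq 0 fun x ↦ ?_
  have := subsingleton_of_projective (A := S) (M := Fin (G.rank 0) → S) (N := C) i
  obtain ⟨y, rfl⟩ := (G.isShortExact_zero.pre_exact₃ i x).mp (this.elim _ _)
  rw [(G.ext_syz_subsingleton C i 0 (by omega)).elim y 0, map_zero]

end MinimalFreeResolution

/-! ### `coker σᵀ` as `Ext^g(S / I, S)` -/

section CokerTranspose

open ExtM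

variable {S : Type u} [CommRing S]

/-- The linear form on `Sⁿ` with given coefficients. -/
noncomputable def dualEquiv (S : Type u) [CommRing S] (n : ℕ) :
    (Fin n → S) ≃ₗ[S] ((Fin n → S) →ₗ[S] S) :=
  (Pi.basisFun S (Fin n)).toDualEquiv

lemma dualEquiv_apply (n : ℕ) (v w : Fin n → S) : dualEquiv S n v w = v ⬝ᵥ w := by
  simp [dualEquiv, Module.Basis.toDualEquiv_apply, Module.Basis.toDual,
    Module.Basis.constr_apply_fintype, dotProduct]

lemma dualEquiv_comp_mulVecLin {m n : ℕ} (D : Matrix (Fin m) (Fin n) S) (v : Fin m → S) :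
    dualEquiv S m v ∘ₗ D.mulVecLin = dualEquiv S n (D.transpose.mulVecLin v) := by
  refine LinearMap.ext fun w ↦ ?_
  rw [LinearMap.comp_apply, dualEquiv_apply, dualEquiv_apply, Matrix.mulVecLin_apply,
    Matrix.mulVecLin_apply, Matrix.mulVec_transpose, Matrix.dotProduct_mulVec]

/-- `Ext¹` of the cokernel of an injective matrix is the cokernel of the transpose. -/
lemma nonempty_ext_one_equiv {m n : ℕ} (D : Matrix (Fin m) (Fin n) S) {K : Type u} [AddCommGroup K]
    [Module S K] {v : (Fin m → S) →ₗ[S] K} (h : IsShortExact D.mulVecLin v) :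
    Nonempty (Coker D.transpose.mulVecLin ≃ₗ[S] ExtM S K S 1) := by
  let ψ : (Fin n → S) →ₗ[S] ExtM S K S 1 :=
    h.preδ S 0 ∘ₗ (zeroEquiv.symm.toLinearMap ∘ₗ (dualEquiv S n).toLinearMap)
  have hsurj : Function.Surjective ψ := by
    have : Function.Surjective (h.preδ S 0) := fun x ↦ (h.pre_exact₃ 0 x).mp
      ((subsingleton_of_projective (A := S) (M := Fin m → S) (N := S) 0).elim _ _)
    exact this.comp (zeroEquiv.symm.surjective.comp (dualEquiv S n).surjective)
  have hker : LinearMap.ker ψ = LinearMap.range D.transpose.mulVecLin := by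
    ext w
    change h.preδ S 0 (zeroEquiv.symm (dualEquiv S n w)) = 0 ↔ _
    rw [h.pre_exact₁ 0 _]
    constructor
    · rintro ⟨y, hy⟩
      obtain ⟨y, rfl⟩ := zeroEquiv.symm.surjective y
      obtain ⟨y, rfl⟩ := (dualEquiv S m).surjective y
      rw [pre_zeroEquiv_symm, dualEquiv_comp_mulVecLin] at hy
      exact ⟨y, (dualEquiv S n).injective (zeroEquiv.symm.injective hy)⟩
    · rintro ⟨y, rfl⟩
      exact ⟨zeroEquiv.symm (dualEquiv S m y), by rw [pre_zeroEquiv_symm, dualEquiv_comp_mulVecLin]⟩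
  exact ⟨(Submodule.quotEquivOfEq _ _ hker.symm).trans (ψ.quotKerEquivOfSurjective hsurj)⟩

end CokerTranspose

namespace MinimalFreeResolution

open ExtM

variable {S : Type u} [CommRing S] [IsLocalRing S] {I : Ideal S} {g : ℕ}
  (G : MinimalFreeResolution I g)

/-- Dimension shifting; all degrees are positive, so the free modules contribute nothing. -/
lemma nonempty_ext_syz_equiv (C : Type u) [AddCommGroup C] [Module S C] (i : ℕ) :
    ∀ j l : ℕ, l = j + i → Nonempty (ExtM S (G.syz l) C 1 ≃ₗ[S] ExtM S (G.syz j) C (i + 1)) := by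
  induction i with
  | zero => rintro j l rfl; exact ⟨LinearEquiv.refl _ _⟩
  | succ i ih =>
    intro j l hl
    obtain ⟨e⟩ := ih (j + 1) l (by omega)
    have h := G.isShortExact_succ j
    have h1 := subsingleton_of_projective (A := S) (M := Fin (G.rank (j + 1)) → S) (N := C) i
    have h2 := subsingleton_of_projective (A := S) (M := Fin (G.rank (j + 1)) → S) (N := C) (i + 1)
    refine ⟨e.trans (LinearEquiv.ofBijective (h.preδ C (i + 1)) ⟨?_, fun x ↦ ?_⟩)⟩
    · refine (injective_iff_map_eq_zero _).mpr fun x hx ↦ ?_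
      obtain ⟨y, rfl⟩ := (h.pre_exact₁ _ x).mp hx
      rw [h1.elim y 0, map_zero]
    · exact (h.pre_exact₃ _ x).mp (h2.elim _ _)

lemma injective_d {j : ℕ} (hj : g ≤ j + 1) : Function.Injective (G.d j).mulVecLin := by
  refine (injective_iff_map_eq_zero _).mpr fun x hx ↦ ?_
  have hs := G.subsingleton_syz hj
  obtain ⟨y, hy⟩ := (G.exact_succ j x).mp hx
  have := hs.elim ⟨x, ⟨y, hy⟩⟩ 0
  exact congrArg Subtype.val this

/-- The cokernel of the dual of the last map of a free resolution of length `g` of `S / I` is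
`Ext^g(S / I, S)`. -/
theorem nonempty_coker_equiv_ext :
    Nonempty (Coker G.lastMap.transpose.mulVecLin ≃ₗ[S] ExtM S (S ⧸ I) S g) := by
  match g, G with
  -- The augmentation is an isomorphism and `σᵀ` has no columns, so its cokernel is the dual of `G_0
  -- ≅ S / I`.
  | 0, G =>
    have hs := G.subsingleton_syz le_rfl
    have hinj : Function.Injective G.augmentation := by
      refine (injective_iff_map_eq_zero _).mpr fun x hx ↦ ?_
      obtain ⟨y, rfl⟩ := (G.isShortExact_zero.exact x).mp hx
      rw [hs.elim y 0, map_zero]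
    let e : (Fin (G.rank 0) → S) ≃ₗ[S] S ⧸ I :=
      LinearEquiv.ofBijective G.augmentation ⟨hinj, G.augmentation_surjective⟩
    have h0 : LinearMap.range G.lastMap.transpose.mulVecLin = ⊥ := by
      rw [LinearMap.range_eq_bot]
      have : G.lastMap = 0 := rfl
      rw [this, Matrix.transpose_zero, Matrix.mulVecLin_zero]
    exact ⟨(Submodule.quotEquivOfEqBot _ h0).trans ((dualEquiv S _).trans
      (zeroEquiv.symm.trans (congrLeft e S 0)))⟩
  | 1, G =>
    refine nonempty_ext_one_equiv (G.d 0) ⟨G.injective_d le_rfl, G.augmentation_surjective,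
      G.exact_zero⟩
  -- `syz m` is resolved by `0 → G_{m+2} → G_{m+1}`; its `Ext¹` is shifted `m` times along the
  -- syzygies and once more along the augmentation.
  | m + 2, G =>
    have h : IsShortExact (G.d (m + 1)).mulVecLin (G.d m).mulVecLin.rangeRestrict :=
      ⟨G.injective_d le_rfl, LinearMap.surjective_rangeRestrict _, fun x ↦ by
        rw [← Subtype.coe_inj, LinearMap.codRestrict_apply, ZeroMemClass.coe_zero]
        exact G.exact_succ m x⟩
    obtain ⟨e₁⟩ := nonempty_ext_one_equiv (G.d (m + 1)) h
    obtain ⟨e₂⟩ := G.nonempty_ext_syz_equiv S m 0 m (by omega)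
    have h' := G.isShortExact_zero
    have h1 := subsingleton_of_projective (A := S) (M := Fin (G.rank 0) → S) (N := S) m
    have h2 := subsingleton_of_projective (A := S) (M := Fin (G.rank 0) → S) (N := S) (m + 1)
    refine ⟨e₁.trans (e₂.trans (LinearEquiv.ofBijective (h'.preδ S (m + 1)) ⟨?_, fun x ↦ ?_⟩))⟩
    · refine (injective_iff_map_eq_zero _).mpr fun x hx ↦ ?_
      obtain ⟨y, rfl⟩ := (h'.pre_exact₁ _ x).mp hx
      rw [h1.elim y 0, map_zero]
    · exact (h'.pre_exact₃ _ x).mp (h2.elim _ _)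

/-- The cokernel of `σᵀ ⊗ S / I` is `Ext^g(S / I, S)`. -/
theorem nonempty_ext_equiv_coker_quot :
    Nonempty (ExtM S (S ⧸ I) S g ≃ₗ[S] Coker G.lastMapTransposeQuot.mulVecLin) := by
  obtain ⟨e⟩ := G.nonempty_coker_equiv_ext
  let q : (Fin (G.rank g) → S) →ₗ[S] (Fin (G.rank g) → S ⧸ I) :=
    LinearMap.compLeft (Algebra.linearMap S (S ⧸ I)) (Fin (G.rank g))
  have hq (v : Fin (G.rank g) → S) (i : Fin (G.rank g)) : q v i = Ideal.Quotient.mk I (v i) := rfl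
  let π : (Fin (G.rank g) → S) →ₗ[S] Coker G.lastMapTransposeQuot.mulVecLin :=
    (LinearMap.range G.lastMapTransposeQuot.mulVecLin).mkQ.restrictScalars S ∘ₗ q
  have hqs : Function.Surjective q := fun v ↦ by
    choose w hw using fun i ↦ Ideal.Quotient.mk_surjective (v i)
    exact ⟨w, funext hw⟩
  have hπ : Function.Surjective π := (Submodule.mkQ_surjective _).comp hqs
  have hcomm (w : Fin (G.prevRank g) → S) : q (G.lastMap.transpose.mulVecLin w) =
      G.lastMapTransposeQuot.mulVecLin (fun i ↦ Ideal.Quotient.mk I (w i)) := by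
    ext i
    rw [hq, Matrix.mulVecLin_apply, Matrix.mulVecLin_apply]
    simp only [Matrix.mulVec, dotProduct, map_sum, map_mul]
    rfl
  have hker : LinearMap.ker π = LinearMap.range G.lastMap.transpose.mulVecLin := by
    ext v
    change Submodule.Quotient.mk (q v) = 0 ↔ _
    rw [Submodule.Quotient.mk_eq_zero]
    constructor
    · rintro ⟨w, hw⟩
      choose w' hw' using fun i ↦ Ideal.Quotient.mk_surjective (w i)
      obtain rfl : (fun i ↦ Ideal.Quotient.mk I (w' i)) = w := funext hw'
      rw [← hcomm] at hw
      have hI (i : Fin (G.rank g)) : (v - G.lastMap.transpose.mulVecLin w') i ∈ I := by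
        rw [← Ideal.Quotient.eq_zero_iff_mem, ← hq, map_sub, hw, sub_self]
        rfl
      -- `I` kills `coker σᵀ ≅ Ext^g(S / I, S)`, so vectors with entries in `I` already lie in the
      -- image of `σᵀ`, and reduction modulo `I` leaves the cokernel unchanged.
      have hmem (u : Fin (G.rank g) → S) (hu : ∀ i, u i ∈ I) :
          u ∈ LinearMap.range G.lastMap.transpose.mulVecLin := by
        have hu' : u = ∑ i, u i • (Pi.single i 1 : Fin (G.rank g) → S) := by
          ext j; simp [Pi.single_apply, Finset.sum_apply]
        rw [hu']
        refine Submodule.sum_mem _ fun i _ ↦ ?_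
        rw [← Submodule.Quotient.mk_eq_zero, Submodule.Quotient.mk_smul]
        apply e.injective
        rw [map_smul, map_zero]
        refine smul_eq_zero_of_annihilator_left (fun m ↦ ?_) _ _
        rw [Algebra.smul_def, Ideal.Quotient.algebraMap_eq,
          Ideal.Quotient.eq_zero_iff_mem.mpr (hu i), zero_mul]
      have := add_mem (hmem _ hI) ⟨w', rfl⟩
      rwa [sub_add_cancel] at this
    · rintro ⟨w, rfl⟩
      exact ⟨_, (hcomm w).symm⟩
  exact ⟨(e.symm.trans (Submodule.quotEquivOfEq _ _ hker.symm)).trans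
    (π.quotKerEquivOfSurjective hπ)⟩

end MinimalFreeResolution

/-! ### Change of rings for `Ext` -/

section ChangeOfRings

open ExtM

variable {S R C W : Type u} [CommRing S] [CommRing R] [Algebra S R]
  [AddCommGroup C] [Module S C] [AddCommGroup W] [Module S W] [Module R W] [IsScalarTower S R W]
  {M M' M'' : Type u} [AddCommGroup M] [Module S M] [Module R M] [IsScalarTower S R M]
  [AddCommGroup M'] [Module S M'] [Module R M'] [IsScalarTower S R M']
  [AddCommGroup M''] [Module S M''] [Module R M''] [IsScalarTower S R M'']

lemma IsShortExact.restrictScalars {f : M →ₗ[R] M'} {g : M' →ₗ[R] M''} (h : IsShortExact f g) :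
    IsShortExact (f.restrictScalars S) (g.restrictScalars S) :=
  ⟨h.injective, h.surjective, h.exact⟩

/-- A semilinear version of passing to the cokernel: an additive bijection, semilinear over
`S → R`, descends along surjections with corresponding kernels. -/
lemma exists_addEquiv_of_ker_iff {B D B' D' : Type*} [AddCommGroup B] [AddCommGroup D]
    [AddCommGroup B'] [AddCommGroup D'] [Module R B] [Module R D] [Module S B'] [Module S D']
    {δ : B →ₗ[R] D} {δ' : B' →ₗ[S] D'} (hδ : Function.Surjective δ) (hδ' : Function.Surjective δ')
    (e : B ≃+ B') (he : ∀ (s : S) b, e (algebraMap S R s • b) = s • e b)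
    (hker : ∀ b, δ b = 0 ↔ δ' (e b) = 0) :
    ∃ e' : D ≃+ D', ∀ (s : S) x, e' (algebraMap S R s • x) = s • e' x := by
  let f : B →+ D' := δ'.toAddMonoidHom.comp e.toAddMonoidHom
  have hf : Function.Surjective f := hδ'.comp e.surjective
  have hk : δ.toAddMonoidHom.ker = f.ker := by
    ext b
    exact hker b
  let e' : D ≃+ D' := (QuotientAddGroup.quotientKerEquivOfSurjective δ.toAddMonoidHom hδ).symm.trans
    ((QuotientAddGroup.quotientAddEquivOfEq hk).trans
      (QuotientAddGroup.quotientKerEquivOfSurjective f hf))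
  have key (b : B) : e' (δ b) = δ' (e b) := by
    have : (QuotientAddGroup.quotientKerEquivOfSurjective δ.toAddMonoidHom hδ).symm (δ b) =
        QuotientAddGroup.mk b := by
      rw [AddEquiv.symm_apply_eq]
      rfl
    simp only [e', AddEquiv.trans_apply, this]
    rfl
  refine ⟨e', fun s x ↦ ?_⟩
  obtain ⟨b, rfl⟩ := hδ x
  rw [← map_smul, key, he, map_smul, key]

/-- The linear map `R → M` with `1 ↦ m`, as an `S`-linear map. -/
noncomputable def spanMap (S : Type u) {R M : Type u} [CommRing S] [CommRing R] [Algebra S R]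
    [AddCommGroup M] [Module S M] [Module R M] [IsScalarTower S R M] (m : M) : R →ₗ[S] M :=
  (LinearMap.toSpanSingleton R M m).restrictScalars S

lemma spanMap_add (m m' : M) : spanMap (R := R) S (m + m') = spanMap S m + spanMap S m' := by
  ext
  simp [spanMap]

lemma spanMap_smul (s : S) (m : M) : spanMap (R := R) S (s • m) = s • spanMap S m := by
  refine LinearMap.ext fun r ↦ ?_
  simp only [spanMap, LinearMap.coe_restrictScalars, LinearMap.toSpanSingleton_apply,
    LinearMap.smul_apply]
  rw [← algebraMap_smul R s m, ← algebraMap_smul R s (r • m), smul_comm]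

lemma comp_spanMap (f : M →ₗ[R] M') (m : M) :
    f.restrictScalars S ∘ₗ spanMap (R := R) S m = spanMap S (f m) := by
  ext
  simp [spanMap]

variable {g : ℕ} (hsurj : Function.Surjective (algebraMap S R)) (ε : ExtM S R C g ≃ₗ[S] W)

/-- The natural map `Ext_S^g(M, C) → Hom_R(M, Ext_S^g(R, C))`. -/
noncomputable def extToHom (M : Type u) [AddCommGroup M] [Module S M] [Module R M]
    [IsScalarTower S R M] (ξ : ExtM S M C g) : M →ₗ[R] W :=
  LinearMap.extendScalarsOfSurjective hsurj
    { toFun := fun m ↦ ε (pre (spanMap S m) C g ξ)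
      map_add' := fun m m' ↦ by
        rw [← map_add, ← pre_add, spanMap_add]
      map_smul' := fun s m ↦ by
        rw [RingHom.id_apply, ← map_smul, ← pre_smul, spanMap_smul] }

lemma extToHom_apply (ξ : ExtM S M C g) (m : M) :
    extToHom hsurj ε M ξ m = ε (pre (spanMap S m) C g ξ) := rfl

lemma extToHom_add (ξ ξ' : ExtM S M C g) :
    extToHom hsurj ε M (ξ + ξ') = extToHom hsurj ε M ξ + extToHom hsurj ε M ξ' := by
  ext m
  simp [extToHom_apply]

lemma extToHom_smul (s : S) (ξ : ExtM S M C g) :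
    extToHom hsurj ε M (s • ξ) = algebraMap S R s • extToHom hsurj ε M ξ := by
  ext m
  simp [extToHom_apply]

lemma extToHom_pre (f : M →ₗ[R] M') (ξ : ExtM S M' C g) :
    extToHom hsurj ε M (pre (f.restrictScalars S) C g ξ) = extToHom hsurj ε M' ξ ∘ₗ f := by
  ext m
  rw [LinearMap.comp_apply, extToHom_apply, extToHom_apply, ← pre_comp, comp_spanMap]

/-- Additivity: a class on `Rⁿ` is recovered from its pullbacks along the coordinate maps `R → Rⁿ`,
and these are arbitrary elements of `W`. -/
lemma extToHom_pi_bijective (n : ℕ) :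
    Function.Bijective (extToHom hsurj ε (Fin n → R)) := by
  have hid : (LinearMap.id : (Fin n → R) →ₗ[S] (Fin n → R)) =
      ∑ j, spanMap S (Pi.single j (1 : R)) ∘ₗ LinearMap.proj j := by
    refine LinearMap.ext fun v ↦ funext fun i ↦ ?_
    simp [spanMap, Pi.single_apply, Finset.sum_apply, LinearMap.sum_apply]
  have hdecomp (ξ : ExtM S (Fin n → R) C g) : ξ = ∑ j, pre (LinearMap.proj j) C g
      (ε.symm (extToHom hsurj ε _ ξ (Pi.single j 1))) := by
    conv_lhs => rw [← pre_id g ξ, hid, pre_sum]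
    refine Finset.sum_congr rfl fun j _ ↦ ?_
    rw [pre_comp, extToHom_apply, LinearEquiv.symm_apply_apply]
  constructor
  · intro ξ ξ' h
    rw [hdecomp ξ, hdecomp ξ', h]
  · intro f
    refine ⟨∑ j, pre (LinearMap.proj j) C g (ε.symm (f (Pi.single j 1))), ?_⟩
    refine LinearMap.pi_ext' fun i ↦ LinearMap.ext_ring ?_
    rw [LinearMap.comp_apply, LinearMap.comp_apply, LinearMap.single_apply, extToHom_apply, map_sum,
      Finset.sum_eq_single i]
    · rw [← pre_comp]
      have : (LinearMap.proj i : (Fin n → R) →ₗ[S] R) ∘ₗ spanMap (R := R) S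
          (Pi.single i (1 : R)) = LinearMap.id := by
        ext; simp [spanMap]
      rw [this, pre_id, LinearEquiv.apply_symm_apply]
    · intro j _ hj
      rw [← pre_comp]
      have : (LinearMap.proj j : (Fin n → R) →ₗ[S] R) ∘ₗ spanMap (R := R) S
          (Pi.single i (1 : R)) = 0 := by
        refine LinearMap.ext fun r ↦ ?_
        simp [spanMap, hj]
      rw [this, pre_zero]
    · simp

/-- `Ext_S^j(M, C)` vanishes for `j < g` and all finitely generated `R`-modules `M`. -/
def ExtVanishesBelow (S R C : Type u) [CommRing S] [CommRing R] [Algebra S R] [AddCommGroup C]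
    [Module S C] (g : ℕ) : Prop :=
  ∀ (M : Type u) [AddCommGroup M] [Module S M] [Module R M] [IsScalarTower S R M]
    [Module.Finite R M], ∀ j < g, Subsingleton (ExtM S M C j)

lemma ExtVanishesBelow.pre_injective (hlt : ExtVanishesBelow S R C g)
    [Module.Finite R M] {P Q : Type u} [AddCommGroup P]
    [Module S P] [AddCommGroup Q] [Module S Q] {f : M →ₗ[S] P} {q : P →ₗ[S] Q}
    (h : IsShortExact f q) : Function.Injective (pre q C g) := by
  match g with
  | 0 => exact h.pre_injective_zero
  | g + 1 =>
    refine (injective_iff_map_eq_zero _).mpr fun x hx ↦ ?_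
    obtain ⟨y, rfl⟩ := (h.pre_exact₃ g x).mp hx
    rw [(hlt M g (by omega)).elim y 0, map_zero]

variable [IsNoetherianRing R]

/-- Both functors are contravariant and left exact, so a free cover reduces to `Rⁿ`. Injectivity,
applied to the kernel of the cover, then gives surjectivity in `extToHom_bijective`. -/
lemma extToHom_injective (hlt : ExtVanishesBelow S R C g)
    (M : Type u) [AddCommGroup M] [Module S M] [Module R M]
    [IsScalarTower S R M] [Module.Finite R M] : Function.Injective (extToHom hsurj ε M) := by
  obtain ⟨n, q, hq⟩ := Module.Finite.exists_fin' R M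
  have h := (isShortExact_ker hq).restrictScalars (S := S)
  intro ξ ξ' hξ
  apply hlt.pre_injective h
  apply (extToHom_pi_bijective hsurj ε n).1
  rw [extToHom_pre, extToHom_pre, hξ]

lemma extToHom_bijective (hlt : ExtVanishesBelow S R C g)
    (M : Type u) [AddCommGroup M] [Module S M] [Module R M]
    [IsScalarTower S R M] [Module.Finite R M] : Function.Bijective (extToHom hsurj ε M) := by
  refine ⟨extToHom_injective hsurj ε hlt M, fun f ↦ ?_⟩
  obtain ⟨n, q, hq⟩ := Module.Finite.exists_fin' R M
  have hR := isShortExact_ker hq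
  have h := hR.restrictScalars (S := S)
  obtain ⟨ξ, hξ⟩ := (extToHom_pi_bijective hsurj ε n).2 (f ∘ₗ q)
  have h0 : pre ((LinearMap.ker q).subtype.restrictScalars S) C g ξ = 0 := by
    apply extToHom_injective hsurj ε hlt
    rw [extToHom_pre, hξ, LinearMap.comp_assoc, hR.exact.linearMap_comp_eq_zero]
    ext
    simp [extToHom_apply]
  obtain ⟨ξ', rfl⟩ := (h.pre_exact₂ g ξ).mp h0
  refine ⟨ξ', ?_⟩
  rw [extToHom_pre] at hξ
  ext m
  obtain ⟨v, rfl⟩ := hq m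
  exact LinearMap.congr_fun hξ v

/-- The isomorphism `Ext_R⁰(M, W) ≅ Ext_S^g(M, C)`. -/
noncomputable def extZeroEquiv (hlt : ExtVanishesBelow S R C g)
    (M : Type u) [AddCommGroup M] [Module S M] [Module R M]
    [IsScalarTower S R M] [Module.Finite R M] : ExtM R M W 0 ≃+ ExtM S M C g :=
  zeroEquiv.toAddEquiv.trans (AddEquiv.ofBijective
    (AddMonoidHom.mk' (extToHom hsurj ε M) (extToHom_add hsurj ε))
    (extToHom_bijective hsurj ε hlt M)).symm

lemma extToHom_extZeroEquiv (hlt : ExtVanishesBelow S R C g)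
    [Module.Finite R M] (x : ExtM R M W 0) :
    extToHom hsurj ε M (extZeroEquiv hsurj ε hlt M x) = zeroEquiv x :=
  (AddEquiv.ofBijective (AddMonoidHom.mk' (extToHom hsurj ε M) (extToHom_add hsurj ε))
    (extToHom_bijective hsurj ε hlt M)).apply_symm_apply (zeroEquiv x)

lemma extZeroEquiv_smul (hlt : ExtVanishesBelow S R C g)
    [Module.Finite R M] (s : S) (x : ExtM R M W 0) :
    extZeroEquiv hsurj ε hlt M (algebraMap S R s • x) = s • extZeroEquiv hsurj ε hlt M x := by
  apply extToHom_injective hsurj ε hlt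
  rw [extToHom_smul, extToHom_extZeroEquiv, extToHom_extZeroEquiv, map_smul]

lemma extZeroEquiv_pre (hlt : ExtVanishesBelow S R C g)
    [Module.Finite R M] [Module.Finite R M'] (f : M →ₗ[R] M')
    (x : ExtM R M' W 0) : extZeroEquiv hsurj ε hlt M (pre f W 0 x) =
      pre (f.restrictScalars S) C g (extZeroEquiv hsurj ε hlt M' x) := by
  apply extToHom_injective hsurj ε hlt
  rw [extToHom_pre, extToHom_extZeroEquiv, extToHom_extZeroEquiv, zeroEquiv_pre]

/-- If `Ext_S^j(M, C)` vanishes for `j < g` and all finitely generated `R`-modules `M`, and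
`Ext_S^j(R, C)` vanishes for `j > g`, then `Ext_R^i(M, Ext_S^g(R, C)) ≅ Ext_S^{g+i}(M, C)`. -/
theorem exists_ext_addEquiv (hsurj : Function.Surjective (algebraMap S R))
    (ε : ExtM S R C g ≃ₗ[S] W) (hlt : ExtVanishesBelow S R C g)
    (hgt : ∀ j, g < j → Subsingleton (ExtM S R C j)) (i : ℕ) :
    ∀ (M : Type u) [AddCommGroup M] [Module S M] [Module R M] [IsScalarTower S R M]
      [Module.Finite R M], ∃ e : ExtM R M W i ≃+ ExtM S M C (g + i),
        ∀ (s : S) x, e (algebraMap S R s • x) = s • e x := by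
  induction i with
  | zero =>
    intro M _ _ _ _ _
    exact ⟨extZeroEquiv hsurj ε hlt M, extZeroEquiv_smul hsurj ε hlt⟩
  | succ i ih =>
    intro M _ _ _ _ _
    obtain ⟨n, q, hq⟩ := Module.Finite.exists_fin' R M
    have hR := isShortExact_ker hq
    have hS := hR.restrictScalars (S := S)
    have hR0 (i : ℕ) := subsingleton_of_projective (A := R) (M := Fin n → R) (N := W) i
    have hS0 (i : ℕ) := subsingleton_pi_left (n := n) (hgt (g + i + 1) (by omega))
    have hδ : Function.Surjective (hR.preδ W i) := fun x ↦
      (hR.pre_exact₃ i x).mp ((hR0 i).elim _ _)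
    have hδ' : Function.Surjective (hS.preδ C (g + i)) := fun x ↦
      (hS.pre_exact₃ (g + i) x).mp ((hS0 i).elim _ _)
    -- In the first step the terms for `Rⁿ` need not vanish, so the kernels are matched by
    -- naturality of `extZeroEquiv`; later both connecting maps are injective.
    match i with
    | 0 =>
      refine exists_addEquiv_of_ker_iff hδ hδ' (extZeroEquiv hsurj ε hlt (LinearMap.ker q))
        (extZeroEquiv_smul hsurj ε hlt) fun b ↦ ?_
      rw [hR.pre_exact₁ 0 b]
      refine Iff.trans ?_ (hS.pre_exact₁ g _).symm
      constructor
      · rintro ⟨a, rfl⟩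
        exact ⟨extZeroEquiv hsurj ε hlt _ a, (extZeroEquiv_pre hsurj ε hlt _ a).symm⟩
      · rintro ⟨a, ha⟩
        obtain ⟨a, rfl⟩ := (extZeroEquiv hsurj ε hlt _).surjective a
        rw [← extZeroEquiv_pre] at ha
        exact ⟨a, (extZeroEquiv hsurj ε hlt _).injective ha⟩
    | i + 1 =>
      obtain ⟨e, he⟩ := ih (LinearMap.ker q)
      refine exists_addEquiv_of_ker_iff hδ hδ' e he fun b ↦ ?_
      have h1 : hR.preδ W (i + 1) b = 0 ↔ b = 0 := by
        refine ⟨fun h ↦ ?_, fun h ↦ by rw [h, map_zero]⟩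
        obtain ⟨a, rfl⟩ := (hR.pre_exact₁ _ b).mp h
        rw [(hR0 i).elim a 0, map_zero]
      have h2 (b) : hS.preδ C (g + (i + 1)) b = 0 ↔ b = 0 := by
        refine ⟨fun h ↦ ?_, fun h ↦ by rw [h, map_zero]⟩
        obtain ⟨a, rfl⟩ := (hS.pre_exact₁ _ b).mp h
        rw [(hS0 i).elim a 0, map_zero]
      rw [h1, h2, EmbeddingLike.map_eq_zero_iff]

end ChangeOfRings

/-! ### The cokernel of `φ` is canonical -/

section Main

open ExtM

variable {S : Type u} [CommRing S] [IsRegularLocalRing S] {I : Ideal S} [IsLocalRing (S ⧸ I)]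
  {g : ℕ}

/-- The residue field of a quotient of a local ring. -/
lemma nonempty_residueField_equiv : Nonempty (ResidueField S ≃ₗ[S] ResidueField (S ⧸ I)) := by
  let f : S →ₗ[S] ResidueField (S ⧸ I) := Algebra.linearMap S (ResidueField (S ⧸ I))
  have hf : Function.Surjective f := residue_surjective.comp Ideal.Quotient.mk_surjective
  have hk : LinearMap.ker f = maximalIdeal S := by
    have : (RingHom.ker (algebraMap S (ResidueField (S ⧸ I)))).IsMaximal :=
      RingHom.ker_isMaximal_of_surjective _ hf
    exact IsLocalRing.eq_maximalIdeal this
  exact ⟨(Submodule.quotEquivOfEq _ _ hk.symm).trans (f.quotKerEquivOfSurjective hf)⟩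

/-- The cokernel of `σᵀ ⊗ R` is a canonical module of `R`. -/
theorem isCanonicalModule_coker (hg : I.height = g) {d : ℕ} (hd : ringKrullDim (S ⧸ I) = d)
    (G : MinimalFreeResolution I g) :
    IsCanonicalModule (S ⧸ I) (Coker G.lastMapTransposeQuot.mulVecLin) := by
  obtain ⟨n, hn⟩ : ∃ n : ℕ, ringKrullDim S = n :=
    ⟨_, ((isRegularLocalRing_iff S).mp inferInstance).symm⟩
  obtain ⟨hext, ⟨e₀⟩⟩ := IsRegularLocalRing.ext_residueField hn
  have hlow : ∀ i < n, Subsingleton (ExtM S (ResidueField S) S i) := fun i hi ↦ hext i hi.ne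
  obtain rfl : n = g + d := le_antisymm (G.le_add_of_ringKrullDim_quotient hlow hd)
    (height_add_ringKrullDim_quotient_le hg hd hn)
  obtain ⟨ε⟩ := G.nonempty_ext_equiv_coker_quot
  have hlt : ExtVanishesBelow S (S ⧸ I) S g := by
    intro M _ _ _ _ _ j hj
    have : Module.Finite S M := Module.Finite.trans (S ⧸ I) M
    refine ext_subsingleton_of_supportDim_le hlow d M ?_ (by omega)
    refine (supportDim_le_ringKrullDim_quotient (I := I) fun s hs ↦ ?_).trans hd.le
    rw [Module.mem_annihilator]
    intro m
    rw [← algebraMap_smul (S ⧸ I) s m, Ideal.Quotient.algebraMap_eq,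
      Ideal.Quotient.eq_zero_iff_mem.mpr hs, zero_smul]
  have key := exists_ext_addEquiv (R := S ⧸ I) Ideal.Quotient.mk_surjective ε hlt
    (fun j hj ↦ G.ext_quotient_subsingleton S hj)
  obtain ⟨ρ⟩ := nonempty_residueField_equiv (S := S) (I := I)
  refine ⟨inferInstance, fun i hi ↦ ?_, fun i hi ↦ ?_⟩
  · obtain ⟨e, -⟩ := key i (ResidueField (S ⧸ I))
    have hi' : g + i ≠ g + d := fun h ↦ hi (by rw [hd, Nat.add_left_cancel h])
    have := hext _ hi'
    exact (e.toEquiv.trans (congrLeft ρ.symm S (g + i)).toEquiv).subsingleton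
  · obtain rfl : i = d := by rw [hd] at hi; exact_mod_cast hi
    obtain ⟨e, he⟩ := key i (ResidueField (S ⧸ I))
    let e' : ExtM (S ⧸ I) (ResidueField (S ⧸ I)) (Coker G.lastMapTransposeQuot.mulVecLin) i ≃+
        ResidueField (S ⧸ I) :=
      e.trans ((congrLeft ρ.symm S (g + i)).trans (e₀.trans ρ)).toAddEquiv
    -- `S → S / I` is onto, so compatibility with scalars from `S` gives linearity over the
    -- quotient.
    refine ⟨{ e' with map_smul' := fun r x ↦ ?_ }⟩
    obtain ⟨s, rfl⟩ := Ideal.Quotient.mk_surjective r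
    change ((congrLeft ρ.symm S (g + i)).trans (e₀.trans ρ)) (e (algebraMap S (S ⧸ I) s • x)) =
      algebraMap S (S ⧸ I) s • ((congrLeft ρ.symm S (g + i)).trans (e₀.trans ρ)) (e x)
    rw [he, map_smul, algebraMap_smul]

end Main

/-! ### Minors and generic cyclicity of a cokernel -/

section Minors

/-- A matrix of rank at least `r` over a field has a nonzero `r × r` minor. -/
lemma exists_submatrix_det_ne_zero {K : Type*} [Field K] {m n r : ℕ} (D : Matrix (Fin m) (Fin n) K)
    (hr : r ≤ D.rank) :
    ∃ (a : Fin r → Fin m) (b : Fin r → Fin n), (D.submatrix a b).det ≠ 0 := by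
  -- `key` selects `r` independent columns; used again on the transpose, it selects rows.
  have key {m n r : ℕ} (D : Matrix (Fin m) (Fin n) K) (hr : r ≤ D.rank) :
      ∃ b : Fin r → Fin n, LinearIndependent K (D.submatrix id b).col := by
    rw [Matrix.rank_eq_finrank_span_cols] at hr
    obtain ⟨f, hf, -, hli⟩ := Submodule.exists_fun_fin_finrank_span_eq K (Set.range D.col)
    choose b hb using hf
    refine ⟨b ∘ Fin.castLE hr, ?_⟩
    have : (D.submatrix id (b ∘ Fin.castLE hr)).col = f ∘ Fin.castLE hr := by
      funext j
      exact hb (Fin.castLE hr j)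
    rw [this]
    exact hli.comp _ (Fin.castLE_injective hr)
  obtain ⟨b, hb⟩ := key D hr
  have hr' : r ≤ (D.submatrix id b).transpose.rank := by
    have h : LinearIndependent K (D.submatrix id b).transpose.row := hb
    rw [h.rank_matrix, Fintype.card_fin]
  obtain ⟨a, ha⟩ := key _ hr'
  refine ⟨a, b, ?_⟩
  have h : ((D.submatrix id b).transpose.submatrix id a).col = (D.submatrix a b).row := rfl
  rw [h, Matrix.linearIndependent_rows_iff_isUnit, Matrix.isUnit_iff_isUnit_det] at ha
  exact ha.ne_zero

variable {R : Type*} [CommRing R] {p q : ℕ}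

/-- The minor of `φ` with rows `a`, times the basis vector `e (a j)`, agrees with an element of
the image of `φ` in the rows `a`. -/
lemma exists_mulVec_eq_of_minor (φ : Matrix (Fin p) (Fin q) R) {r : ℕ} (a : Fin r → Fin p)
    (b : Fin r → Fin q) (j : Fin r) :
    ∃ v : Fin q → R, ∀ i, φ.mulVec v (a i) = if i = j then (φ.submatrix a b).det else 0 := by
  -- The `j`-th column of the adjugate gives the coefficients of the columns `b k`.
  refine ⟨∑ k, (φ.submatrix a b).adjugate k j • Pi.single (b k) 1, fun i ↦ ?_⟩
  have h := congrFun (congrFun (Matrix.mul_adjugate (φ.submatrix a b)) i) j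
  rw [Matrix.mul_apply, Matrix.smul_apply, Matrix.one_apply] at h
  rw [Matrix.mulVec_sum, Finset.sum_apply]
  simp only [Matrix.mulVec_smul, Matrix.mulVec_single_one, Pi.smul_apply, smul_eq_mul,
    Matrix.col_apply]
  simp only [Matrix.submatrix_apply, smul_eq_mul, mul_ite, mul_one, mul_zero] at h
  rw [← h]
  exact Finset.sum_congr rfl fun k _ ↦ mul_comm _ _

/-- The class of a basis vector in the cokernel of a matrix. -/
abbrev cokerBasis (φ : Matrix (Fin p) (Fin q) R) (i : Fin p) : Coker φ.mulVecLin :=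
  Submodule.Quotient.mk (Pi.single i 1)

lemma mk_eq_sum_cokerBasis (φ : Matrix (Fin p) (Fin q) R) (v : Fin p → R) :
    (Submodule.Quotient.mk v : Coker φ.mulVecLin) = ∑ i, v i • cokerBasis φ i := by
  have hv : v = ∑ i, v i • (Pi.single i 1 : Fin p → R) := by
    ext j; simp [Pi.single_apply, Finset.sum_apply]
  conv_lhs => rw [hv]
  change Submodule.mkQ _ _ = _
  rw [map_sum]
  rfl

/-- Modulo the image of `φ`, the minor times `e (a j)` is a combination of basis vectors outside the
rows `a`. Used with `r = p`, `N = 0` and with `r = p - 1`, `N` cyclic. -/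
lemma minor_smul_cokerBasis (φ : Matrix (Fin p) (Fin q) R) {r : ℕ} (a : Fin r → Fin p)
    (b : Fin r → Fin q) (N : Submodule R (Coker φ.mulVecLin))
    (hN : ∀ i, i ∉ Set.range a → cokerBasis φ i ∈ N) (w : Coker φ.mulVecLin) :
    (φ.submatrix a b).det • w ∈ N := by
  have key (i : Fin p) : (φ.submatrix a b).det • cokerBasis φ i ∈ N := by
    by_cases hi : i ∈ Set.range a
    · obtain ⟨j, rfl⟩ := hi
      obtain ⟨v, hv⟩ := exists_mulVec_eq_of_minor φ a b j
      have h0 : (Submodule.Quotient.mk (φ.mulVec v) : Coker φ.mulVecLin) = 0 :=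
        (Submodule.Quotient.mk_eq_zero _).mpr ⟨v, rfl⟩
      rw [mk_eq_sum_cokerBasis, ← Finset.add_sum_erase _ _ (Finset.mem_univ (a j)), hv j,
        if_pos rfl] at h0
      rw [eq_neg_of_add_eq_zero_left h0]
      refine N.neg_mem (Submodule.sum_mem _ fun i hi ↦ ?_)
      by_cases hia : i ∈ Set.range a
      · obtain ⟨k, rfl⟩ := hia
        rw [hv k, if_neg fun h ↦ by simp [h] at hi, zero_smul]
        exact N.zero_mem
      · exact N.smul_mem _ (hN i hia)
    · exact N.smul_mem _ (hN i hi)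
  obtain ⟨v, rfl⟩ := Submodule.Quotient.mk_surjective _ w
  rw [mk_eq_sum_cokerBasis, Finset.smul_sum]
  refine Submodule.sum_mem _ fun i _ ↦ ?_
  rw [smul_comm]
  exact N.smul_mem _ (key i)

/-- The maximal minors annihilate the cokernel. -/
lemma smul_eq_zero_of_mem_minorsIdeal (φ : Matrix (Fin p) (Fin q) R) {x : R}
    (hx : x ∈ minorsIdeal φ p) (w : Coker φ.mulVecLin) : x • w = 0 := by
  have hle : minorsIdeal φ p ≤ Module.annihilator R (Coker φ.mulVecLin) := by
    refine Ideal.span_le.mpr ?_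
    rintro _ ⟨a, b, rfl⟩
    rw [SetLike.mem_coe, Module.mem_annihilator]
    intro w
    by_cases ha : Function.Injective a
    · rw [← Submodule.mem_bot R]
      exact minor_smul_cokerBasis φ a b ⊥
        (fun i hi ↦ absurd ((Finite.injective_iff_surjective.mp ha) i) hi) w
    · obtain ⟨i, j, hij, hne⟩ : ∃ i j, a i = a j ∧ i ≠ j := by
        simpa [Function.Injective] using ha
      rw [Matrix.det_zero_of_row_eq hne (by ext k; simp [hij]), zero_smul]
  exact Module.mem_annihilator.mp (hle hx) w

/-- If the ideal of submaximal minors is not contained in a prime `P`, the cokernel is cyclic up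
to multiplication by an element outside of `P`. -/
lemma exists_smul_mem_span_of_minorsIdeal (φ : Matrix (Fin p) (Fin q) R) (hp : p ≠ 0) {P : Ideal R}
    (hP : ¬ minorsIdeal φ (p - 1) ≤ P) :
    ∃ δ ∉ P, ∃ w₀ : Coker φ.mulVecLin, ∀ w : Coker φ.mulVecLin, ∃ c : R, c • w₀ = δ • w := by
  obtain ⟨_, ⟨a, b, rfl⟩, hδ⟩ : ∃ x ∈ {x | ∃ (a : Fin (p - 1) → Fin p) (b : Fin (p - 1) → Fin q),
      x = (φ.submatrix a b).det}, x ∉ P := by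
    by_contra! h
    exact hP (Ideal.span_le.mpr h)
  have ha : Function.Injective a := by
    by_contra ha
    obtain ⟨i, j, hij, hne⟩ : ∃ i j, a i = a j ∧ i ≠ j := by
      simpa [Function.Injective] using ha
    exact hδ (by rw [Matrix.det_zero_of_row_eq hne (by ext k; simp [hij])]; exact zero_mem _)
  -- The `p - 1` distinct rows `a` omit exactly one row, whose basis vector is the generator.
  obtain ⟨i₀, hi₀⟩ : ∃ i₀, ∀ i, i ∉ Set.range a → i = i₀ := by
    classical
    have hcard : (Finset.univ \ Finset.univ.image a).card = 1 := by
      rw [Finset.card_sdiff_of_subset (Finset.subset_univ _), Finset.card_image_of_injective _ ha]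
      simp
      omega
    obtain ⟨i₀, h⟩ := Finset.card_eq_one.mp hcard
    refine ⟨i₀, fun i hi ↦ ?_⟩
    have : i ∈ Finset.univ \ Finset.univ.image a := by simpa using hi
    rw [h] at this
    simpa using this
  refine ⟨_, hδ, cokerBasis φ i₀, fun w ↦ Submodule.mem_span_singleton.mp ?_⟩
  exact minor_smul_cokerBasis φ a b _
    (fun i hi ↦ by rw [hi₀ i hi]; exact Submodule.mem_span_singleton_self _) w

/-- If the cokernel of `φ` is cyclic up to multiplication by an element outside of a prime `P`,
then the ideal of submaximal minors of `φ` is not contained in `P`. -/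
lemma not_minorsIdeal_le_of_smul_mem_span (φ : Matrix (Fin p) (Fin q) R) {P : Ideal R} [P.IsPrime]
    {x : R} (hx : x ∉ P) (w₀ : Coker φ.mulVecLin)
    (h : ∀ w : Coker φ.mulVecLin, ∃ c : R, x • w = c • w₀) : ¬ minorsIdeal φ (p - 1) ≤ P := by
  -- Over the residue field `K` of `P`, the image of `x` is invertible, so the columns of `φ` and
  -- the image of `c` span `Kᵖ`; hence `φ` has rank at least `p - 1` over `K`.
  let K := FractionRing (R ⧸ P)
  let f : R →+* K := (algebraMap (R ⧸ P) K).comp (Ideal.Quotient.mk P)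
  have hf (r : R) : f r = 0 ↔ r ∈ P := by
    rw [← Ideal.Quotient.eq_zero_iff_mem]
    exact (FaithfulSMul.algebraMap_injective (R ⧸ P) K).eq_iff' (map_zero _)
  obtain ⟨c, rfl⟩ := Submodule.Quotient.mk_surjective _ w₀
  have hcol (i : Fin p) : ∃ (a : R) (v : Fin q → R), φ.mulVec v = x • Pi.single i 1 - a • c := by
    obtain ⟨a, ha⟩ := h (cokerBasis φ i)
    rw [← Submodule.Quotient.mk_smul, ← Submodule.Quotient.mk_smul, Submodule.Quotient.eq] at ha
    exact ⟨a, ha⟩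
  let V : Submodule K (Fin p → K) := LinearMap.range (φ.map f).mulVecLin
  have hV (i : Fin p) : ∃ a : K, f x • Pi.single i 1 - a • (f ∘ c) ∈ V := by
    obtain ⟨a, v, hv⟩ := hcol i
    refine ⟨f a, f ∘ v, ?_⟩
    ext j
    rw [Matrix.mulVecLin_apply, ← RingHom.map_mulVec, hv]
    by_cases hij : j = i
    · subst hij; simp
    · simp [hij]
  have htop : V ⊔ Submodule.span K {f ∘ c} = ⊤ := by
    rw [eq_top_iff, ← (Pi.basisFun K (Fin p)).span_eq, Submodule.span_le]
    rintro _ ⟨i, rfl⟩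
    obtain ⟨a, ha⟩ := hV i
    have hx0 : f x ≠ 0 := fun h ↦ hx ((hf x).mp h)
    have h1 : f x • (Pi.single i 1 : Fin p → K) ∈ V ⊔ Submodule.span K {f ∘ c} := by
      rw [← sub_add_cancel (f x • (Pi.single i 1 : Fin p → K)) (a • (f ∘ c))]
      exact add_mem (Submodule.mem_sup_left ha) (Submodule.mem_sup_right
        (Submodule.smul_mem _ _ (Submodule.mem_span_singleton_self _)))
    have h2 := Submodule.smul_mem _ (f x)⁻¹ h1
    rw [smul_smul, inv_mul_cancel₀ hx0, one_smul] at h2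
    rwa [Pi.basisFun_apply]
  have hrank : p - 1 ≤ (φ.map f).rank := by
    have h1 := Submodule.finrank_add_le_finrank_add_finrank V (Submodule.span K {f ∘ c})
    rw [htop, finrank_top, Module.finrank_fin_fun] at h1
    have h2 := finrank_span_le_card (R := K) ({f ∘ c} : Set (Fin p → K))
    simp only [Set.toFinset_singleton, Finset.card_singleton] at h2
    have h3 : Module.finrank K V = (φ.map f).rank := rfl
    omega
  obtain ⟨a, b, hab⟩ := exists_submatrix_det_ne_zero (φ.map f) hrank
  intro hle
  apply hab
  rw [Matrix.submatrix_map, ← RingHom.mapMatrix_apply, ← RingHom.map_det, hf]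
  exact hle (Ideal.subset_span ⟨a, b, rfl⟩)

end Minors

/-! ### Associated primes of Cohen–Macaulay rings -/

section CohenMacaulay

open ExtM

variable {R : Type u} [CommRing R] [IsLocalRing R]

lemma residueField_smul_eq_zero {x : R} (hx : x ∈ maximalIdeal R) (m : ResidueField R) :
    x • m = 0 := by
  rw [Algebra.smul_def, ResidueField.algebraMap_eq, (residue_eq_zero_iff x).mpr hx, zero_mul]

/-- An ideal of a Noetherian ring not contained in any associated prime contains a regular
element. -/
lemma exists_isSMulRegular_of_not_le {R : Type*} [CommRing R] [IsNoetherianRing R] {I : Ideal R}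
    (hI : ∀ P ∈ associatedPrimes R R, ¬ I ≤ P) : ∃ x ∈ I, IsSMulRegular R x := by
  by_contra! h
  have hsub : (I : Set R) ⊆ ⋃ P ∈ associatedPrimes R R, (P : Set R) := by
    rw [biUnion_associatedPrimes_eq_compl_regular]
    exact fun x hx ↦ h x hx
  obtain ⟨P, hP, hle⟩ := (Ideal.subset_union_prime_finite (associatedPrimes.finite R R) ⊥ ⊥
    fun P hP _ _ ↦ hP.isPrime).mp hsub
  exact hI P hP hle

/-- The associated primes of a Cohen–Macaulay local ring are minimal. -/
lemma IsCohenMacaulayLocal.mem_minimalPrimes (hR : IsCohenMacaulayLocal R) {P : Ideal R}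
    (hP : P ∈ associatedPrimes R R) : P ∈ minimalPrimes R := by
  have := hR.1
  obtain ⟨-, rs, hm, reg, hd⟩ := hR
  have hPp : P.IsPrime := hP.isPrime
  have hext : ∀ i < rs.length, Subsingleton (ExtM R (ResidueField R) R i) := fun i hi ↦
    ext_subsingleton_of_isWeaklyRegular reg.toIsWeaklyRegular
      (fun r hr ↦ residueField_smul_eq_zero (hm r hr)) hi
  obtain ⟨Q, hQ, hQP⟩ := Ideal.exists_minimalPrimes_le (bot_le : ⊥ ≤ P)
  have hQp : Q.IsPrime := hQ.isPrime
  by_cases hne : Q = P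
  · rwa [← hne]
  exfalso
  -- `x` is regular on `R / Q` and `R / P` is a quotient of `(R / Q) / x`, so `dim R / P < dim R`,
  -- which is the depth; hence `Hom(R / P, R) = 0`, although `P` is associated.
  obtain ⟨x, hxP, hxQ⟩ := SetLike.exists_of_lt (lt_of_le_of_ne hQP hne)
  have hxm : x ∈ maximalIdeal R := le_maximalIdeal hPp.ne_top hxP
  have regx := isSMulRegular_of_equiv_quotient_prime (LinearEquiv.refl R (R ⧸ Q)) hxQ
  have h1 := Module.supportDim_quotSMulTop_succ_eq_supportDim regx hxm
  have h2 : Module.supportDim R (R ⧸ Q) ≤ rs.length := by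
    rw [hd]
    exact Module.supportDim_le_ringKrullDim R _
  have hnt : Nontrivial (QuotSMulTop x (R ⧸ Q)) := nontrivial_quotSMulTop_of_mem_maximalIdeal _ hxm
  obtain ⟨t, ht, hle⟩ := exists_eq_add_one_of_add_one_le
    (Module.supportDim_ne_bot_of_nontrivial R (QuotSMulTop x (R ⧸ Q))) (h1.trans_le h2)
  have h3 : Module.supportDim R (R ⧸ P) ≤ t := by
    refine (Module.supportDim_le_of_surjective (Submodule.liftQ _ (Submodule.factor hQP) ?_ :
      QuotSMulTop x (R ⧸ Q) →ₗ[R] R ⧸ P) ?_).trans hle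
    · rintro _ ⟨y, -, rfl⟩
      obtain ⟨y, rfl⟩ := Ideal.Quotient.mk_surjective y
      exact Ideal.Quotient.eq_zero_iff_mem.mpr (P.mul_mem_right y hxP)
    · intro y
      obtain ⟨y, rfl⟩ := Ideal.Quotient.mk_surjective y
      exact ⟨Submodule.Quotient.mk (Submodule.Quotient.mk y), rfl⟩
  have h4 := ext_subsingleton_of_supportDim_le hext t (R ⧸ P) h3 (i := 0) (by omega)
  have h5 : Subsingleton ((R ⧸ P) →ₗ[R] R) := 
    (ExtM.zeroEquiv (A := R) (M := R ⧸ P) (N := R)).toEquiv.symm.subsingleton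
  obtain ⟨r, hr⟩ := (isAssociatedPrime_iff.mp hP).2
  have hker : P ≤ LinearMap.ker (LinearMap.toSpanSingleton R R r) := by
    intro y hy
    rw [hr] at hy
    simpa [Submodule.mem_colon_singleton] using hy
  have h6 := LinearMap.congr_fun (Subsingleton.elim (Submodule.liftQ P _ hker) 0)
    (Submodule.Quotient.mk 1)
  have hr0 : r = 0 := by
    rw [← one_smul R r]
    exact h6
  apply hPp.ne_top
  rw [hr, hr0, Ideal.eq_top_iff_one]
  simp [Submodule.mem_colon_singleton]

/-- In a Cohen–Macaulay local ring an ideal not contained in any minimal prime contains a regular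
element. -/
lemma IsCohenMacaulayLocal.exists_isSMulRegular (hR : IsCohenMacaulayLocal R) {I : Ideal R}
    (hI : ∀ P ∈ minimalPrimes R, ¬ I ≤ P) : ∃ x ∈ I, IsSMulRegular R x := by
  have := hR.1
  exact exists_isSMulRegular_of_not_le fun P hP ↦ hI P (hR.mem_minimalPrimes hP)

end CohenMacaulay

lemma Ideal.one_le_height_iff {R : Type*} [CommRing R] (I : Ideal R) :
    1 ≤ I.height ↔ ∀ P ∈ minimalPrimes R, ¬ I ≤ P := by
  rw [Order.one_le_iff_ne_zero]
  constructor
  · intro h P hP hle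
    have := hP.isPrime
    exact h (le_antisymm ((Ideal.height_mono hle).trans (Ideal.height_eq_zero_iff.mpr hP).le)
      bot_le)
  · intro h h0
    rw [Ideal.height_eq_inf_minimalPrimes] at h0
    simp only [ENat.iInf_eq_zero] at h0
    obtain ⟨P, hP, h0⟩ := h0
    have := hP.isPrime
    exact h P (Ideal.height_eq_zero_iff.mp h0) hP.le

/-! ### Embedding a canonical module as an ideal -/

section IdealEmbedding

variable {R : Type u} [CommRing R] [IsLocalRing R] {W : Type u} [AddCommGroup W] [Module R W]

/-- A canonical module is cyclic up to multiplication by a regular element if it is so at every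
minimal prime. -/
lemma exists_isSMulRegular_smul_mem_span (hR : IsCohenMacaulayLocal R)
    (h : ∀ P ∈ minimalPrimes R, ∃ δ ∉ P, ∃ w₀ : W, ∀ w : W, ∃ c : R, c • w₀ = δ • w) :
    ∃ s : R, IsSMulRegular R s ∧ ∃ w₀ : W, ∀ w : W, ∃ c : R, c • w₀ = s • w := by
  classical
  have := hR.1
  have hfin : (minimalPrimes R).Finite := minimalPrimes.finite_of_isNoetherianRing R
  have hprime (P : Ideal R) (hP : P ∈ minimalPrimes R) : P.IsPrime := hP.isPrime
  -- Minimal primes are incomparable, so the intersection of the others is not inside `P`. The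
  -- elements `u P` combine the local generators into one generator `w`.
  have hu (P : Ideal R) (hP : P ∈ minimalPrimes R) :
      ∃ u ∉ P, ∀ Q ∈ minimalPrimes R, Q ≠ P → u ∈ Q := by
    have hp := hprime P hP
    have hnle : ¬ (hfin.toFinset.erase P).inf id ≤ P := by
      rw [hp.inf_le']
      rintro ⟨Q, hQ, hle⟩
      simp only [Finset.mem_erase, Set.Finite.mem_toFinset] at hQ
      exact hQ.1 (le_antisymm hle (hP.2 ⟨hprime Q hQ.2, bot_le⟩ hle))
    obtain ⟨u, hu, huP⟩ := SetLike.not_le_iff_exists.mp hnle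
    refine ⟨u, huP, fun Q hQ hne ↦ ?_⟩
    exact Finset.inf_le (f := id) (b := Q) (by simp [hQ, hne]) hu
  choose! δ hδ w₀ hw using h
  choose! u huP huQ using hu
  let w : W := ∑ P ∈ hfin.toFinset, u P • w₀ P
  obtain ⟨s, hs, hreg⟩ := hR.exists_isSMulRegular
    (I := Module.annihilator R (W ⧸ Submodule.span R {w})) fun P hP hle ↦ by
      have hp := hprime P hP
      choose c hc using hw P hP
      -- Modulo `P` only `δ P * u P` survives, so `a ∉ P`; and `a • w₀ P = δ P • w` shows that `a *
      -- δ P` maps `W` into `R w`.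
      let a : R := δ P * u P + ∑ Q ∈ hfin.toFinset.erase P, u Q * c (w₀ Q)
      have ha : a • w₀ P = δ P • w := by
        have hPm : P ∈ hfin.toFinset := by simpa using hP
        simp only [a, w]
        rw [← Finset.add_sum_erase _ _ hPm, smul_add, add_smul, smul_smul, Finset.smul_sum,
          Finset.sum_smul]
        congr 1
        refine Finset.sum_congr rfl fun Q _ ↦ ?_
        rw [mul_smul, hc, smul_comm]
      have haP : a ∉ P := by
        rw [Ideal.add_mem_iff_left _ (Ideal.sum_mem _ fun Q hQ ↦ ?_)]
        · exact fun h ↦ (hp.mem_or_mem h).elim (hδ P hP) (huP P hP)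
        · simp only [Finset.mem_erase, Set.Finite.mem_toFinset] at hQ
          exact P.mul_mem_right _ (huQ Q hQ.2 P hP hQ.1.symm)
      have hmem : a * δ P ∈ Module.annihilator R (W ⧸ Submodule.span R {w}) := by
        rw [Module.mem_annihilator]
        intro v
        obtain ⟨v, rfl⟩ := Submodule.Quotient.mk_surjective _ v
        rw [← Submodule.Quotient.mk_smul, Submodule.Quotient.mk_eq_zero,
          Submodule.mem_span_singleton]
        refine ⟨c v * δ P, ?_⟩
        rw [mul_smul, ← ha, smul_comm, hc, mul_smul]
      exact (hp.mem_or_mem (hle hmem)).elim haP (hδ P hP)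
  refine ⟨s, hreg, w, fun v ↦ Submodule.mem_span_singleton.mp ?_⟩
  rw [← Submodule.Quotient.mk_eq_zero, Submodule.Quotient.mk_smul]
  exact Module.mem_annihilator.mp hs _

/-- A canonical module which is cyclic up to multiplication by a regular element is isomorphic to
an ideal. -/
lemma IsCanonicalModule.exists_equiv_ideal [IsNoetherianRing R] (hW : IsCanonicalModule R W)
    {d : ℕ} (hd : (d : WithBot ℕ∞) = ringKrullDim R) {s : R} (hs : IsSMulRegular R s) (w₀ : W)
    (h : ∀ w : W, ∃ c : R, c • w₀ = s • w) : ∃ J : Ideal R, Nonempty (W ≃ₗ[R] J) := by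
  have hsW : IsSMulRegular W s := hW.isSMulRegular hd hs
  -- If `r w₀ = 0`, then `r` kills `s W`, hence `W`, and faithfulness gives `r = 0`. So the
  -- coefficient `c` is unique and depends linearly on `w`.
  have hinj : ∀ r : R, r • w₀ = 0 → r = 0 := fun r hr ↦ hW.eq_zero_of_smul hd fun w ↦ by
    obtain ⟨c, hc⟩ := h w
    apply hsW
    change s • r • w = s • (0 : W)
    rw [smul_comm, ← hc, smul_comm, hr, smul_zero, smul_zero]
  have huniq {a b : R} (hab : a • w₀ = b • w₀) : a = b :=
    sub_eq_zero.mp (hinj _ (by rw [sub_smul, hab, sub_self]))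
  choose c hc using h
  let f : W →ₗ[R] R :=
    { toFun := c
      map_add' := fun v w ↦ huniq (by rw [hc, add_smul, hc, hc, smul_add])
      map_smul' := fun r w ↦ huniq (by
        rw [hc, RingHom.id_apply, smul_assoc, hc, smul_comm]) }
  have hf : Function.Injective f := fun v w hvw ↦ hsW (by
    change s • v = s • w
    rw [← hc v, ← hc w]
    exact congrArg (· • w₀) hvw)
  exact ⟨LinearMap.range f, ⟨LinearEquiv.ofInjective f hf⟩⟩

/-- A canonical module isomorphic to an ideal is cyclic up to multiplication by a regular
element. -/
lemma IsCanonicalModule.exists_isSMulRegular_of_equiv_ideal [IsNoetherianRing R]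
    (hW : IsCanonicalModule R W) {d : ℕ} (hd : (d : WithBot ℕ∞) = ringKrullDim R) {J : Ideal R}
    (e : W ≃ₗ[R] J) :
    ∃ x : R, IsSMulRegular R x ∧ ∃ w₀ : W, ∀ w : W, ∃ c : R, x • w = c • w₀ := by
  obtain ⟨x, hxJ, hx⟩ : ∃ x ∈ J, IsSMulRegular R x := by
    -- Otherwise `J` lies in an associated prime, the annihilator of some `r`; then `r` kills `J ≅
    -- W`, so `r = 0`, which is absurd.
    refine exists_isSMulRegular_of_not_le fun P hP hle ↦ ?_
    obtain ⟨r, hr⟩ := (isAssociatedPrime_iff.mp hP).2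
    have hr0 : r = 0 := hW.eq_zero_of_smul hd fun w ↦ e.injective (Subtype.ext (by
      have := hle (e w).2
      rw [hr] at this
      simpa [Submodule.mem_colon_singleton, mul_comm] using this))
    apply hP.isPrime.ne_top
    rw [hr, hr0, Ideal.eq_top_iff_one]
    simp [Submodule.mem_colon_singleton]
  refine ⟨x, hx, e.symm ⟨x, hxJ⟩, fun w ↦ ⟨(e w : R), e.injective (Subtype.ext ?_)⟩⟩
  simp [mul_comm]

end IdealEmbedding

/-- A canonical module of a Cohen–Macaulay local ring presented by a matrix `φ` with `p` rows is
isomorphic to an ideal if and only if `ht I_{p-1}(φ) ≥ 1` and `I_p(φ) = 0`. -/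
theorem exists_coker_equiv_ideal_iff {R : Type u} [CommRing R] [IsLocalRing R]
    (hR : IsCohenMacaulayLocal R) {p q : ℕ} (φ : Matrix (Fin p) (Fin q) R)
    (hW : IsCanonicalModule R (Coker φ.mulVecLin)) :
    (∃ J : Ideal R, Nonempty (Coker φ.mulVecLin ≃ₗ[R] J)) ↔
      1 ≤ (minorsIdeal φ (p - 1)).height ∧ minorsIdeal φ p = ⊥ := by
  have := hR.1
  obtain ⟨rs, -, -, hd⟩ := hR.2
  rw [Ideal.one_le_height_iff]
  constructor
  · rintro ⟨J, ⟨e⟩⟩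
    refine ⟨fun P hP ↦ ?_, (Submodule.eq_bot_iff _).mpr fun x hx ↦
      hW.eq_zero_of_smul hd (smul_eq_zero_of_mem_minorsIdeal φ hx)⟩
    have := hP.isPrime
    obtain ⟨x, hx, w₀, h⟩ := hW.exists_isSMulRegular_of_equiv_ideal hd e
    refine not_minorsIdeal_le_of_smul_mem_span φ (fun hxP ↦ ?_) w₀ h
    exact Set.disjoint_left.mp (Ideal.disjoint_nonZeroDivisors_of_mem_minimalPrimes hP) hxP
      ((isRegular_iff_mem_nonZeroDivisors).mp ((isLeftRegular_iff_isRegular).mp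
        (isLeftRegular_iff.mpr hx)))
  · rintro ⟨h, -⟩
    -- A matrix without rows has zero cokernel, which is not faithful; this also keeps the truncated
    -- `p - 1` honest.
    have hp : p ≠ 0 := by
      rintro rfl
      exact one_ne_zero (hW.eq_zero_of_smul hd (r := 1) fun w ↦ Subsingleton.elim _ _)
    obtain ⟨s, hs, w₀, hw⟩ := exists_isSMulRegular_smul_mem_span hR
      fun P hP ↦ exists_smul_mem_span_of_minorsIdeal φ hp (h P hP)
    exact hW.exists_equiv_ideal hd hs w₀ hw

/-! ### The Auslander dual and the conclusion -/

lemma nonempty_auslanderDual_equiv {R : Type u} [CommRing R] {p q : ℕ}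
    (φ : Matrix (Fin p) (Fin q) R) :
    Nonempty (AuslanderDual φ.mulVecLin ≃ₗ[R] Coker φ.transpose.mulVecLin) := by
  refine ⟨(Submodule.Quotient.equiv _ _ (dualEquiv R q) ?_).symm⟩
  ext f
  constructor
  · rintro ⟨_, ⟨v, rfl⟩, rfl⟩
    exact ⟨dualEquiv R p v, dualEquiv_comp_mulVecLin φ v⟩
  · rintro ⟨f, rfl⟩
    obtain ⟨v, rfl⟩ := (dualEquiv R p).surjective f
    exact ⟨_, ⟨v, rfl⟩, (dualEquiv_comp_mulVecLin φ v).symm⟩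

theorem proposition3p5 {S : Type u} [CommRing S] [IsRegularLocalRing S]
    (I : Ideal S) [IsLocalRing (S ⧸ I)] (g : ℕ) (hg : I.height = g)
    (hCM : IsCohenMacaulayLocal (S ⧸ I)) (G : MinimalFreeResolution I g) :
    IsCanonicalModule (S ⧸ I) (Coker G.lastMapTransposeQuot.mulVecLin) ∧
    ∀ (ω : Type u) [AddCommGroup ω] [Module (S ⧸ I) ω], IsCanonicalModule (S ⧸ I) ω →
      Nonempty (ω ≃ₗ[S ⧸ I] Coker G.lastMapTransposeQuot.mulVecLin) ∧
      (∃ π : (Fin (G.rank g) → S ⧸ I) →ₗ[S ⧸ I] ω,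
        IsFreePresentation G.lastMapTransposeQuot.mulVecLin π ∧
        Nonempty (AuslanderDual G.lastMapTransposeQuot.mulVecLin ≃ₗ[S ⧸ I]
          Coker G.lastMapQuot.mulVecLin)) ∧
      ((∃ J : Ideal (S ⧸ I), Nonempty (ω ≃ₗ[S ⧸ I] J)) ↔
        1 ≤ (minorsIdeal G.lastMapTransposeQuot (G.rank g - 1)).height ∧
          minorsIdeal G.lastMapTransposeQuot (G.rank g) = ⊥) := by
  obtain ⟨rs, -, -, hd⟩ := hCM.2
  have hW := isCanonicalModule_coker hg hd.symm G
  refine ⟨hW, fun ω _ _ hω ↦ ?_⟩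
  obtain ⟨e⟩ := hW.nonempty_linearEquiv hCM hω
  refine ⟨⟨e⟩, ⟨e.symm.toLinearMap ∘ₗ Submodule.mkQ _, ⟨inferInstance, inferInstance,
    inferInstance, inferInstance, e.symm.surjective.comp (Submodule.mkQ_surjective _),
    fun x ↦ ?_⟩, nonempty_auslanderDual_equiv _⟩, ?_⟩
  · rw [LinearMap.comp_apply, LinearEquiv.coe_coe, map_eq_zero_iff _ e.symm.injective,
      Submodule.mkQ_apply, Submodule.Quotient.mk_eq_zero]
    rfl
  · rw [← exists_coker_equiv_ideal_iff hCM _ hW]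
    exact exists_congr fun J ↦ ⟨fun ⟨f⟩ ↦ ⟨e.symm.trans f⟩, fun ⟨f⟩ ↦ ⟨e.trans f⟩⟩
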